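/- **Theorem 1.5 (Small deviations).** For every $K>0$ and $L>0$ there are constants $C_0,c>0$, depending only on $K$ and $L$, with the following property. For every $n$ let $x^{(n)}=(x_{ij})_{i,j=1}^n$ be an array of independent complex random variables (not necessarily identically or symmetrically distributed), all defined on one probability space (the joint law for different $n$ is arbitrary), with $$\mathbb E[x_{ij}]=0,\qquad \mathbb E[|x_{ij}|^2]=1,\qquad \mathbb E[|x_{ij}|^m]\le (Km)^m\quad\text{for all integers } m\ge 1 .$$ Let $b^{(n)}=(b_{ij})_{i,j=1}^n$ be deterministic non-negative numbers, and put $A_n=(b_{ij}x_{ij})_{i,j=1}^n$, $S_n=(b_{ij}^2)_{i,j=1}^n$ and $\sigma_*=\sigma_*(n)=\sup_{i,j}b_{ij}$. Let $\underline\sigma=\underline\sigma_n>0$ (possibly depending on $n$) be such that $S_n$ is long-time controlled by $\underline\sigma_n$ with constant $L$, that is, for all $k\ge 1$, $$\sup_i\sum_{j=1}^n[S_n^k]_{ij}\le L\,\underline\sigma_n^{2k},\qquad \sup_i\sum_{j=1}^n[(S_n^{T})^k]_{ij}\le L\,\underline\sigma_n^{2k}.$$ Assume $\sigma_*\ll(\log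 n)^{-1}$, i.e. $\sigma_*(n)\log n\to 0$ as $n\to\infty$. Then, with $\rho$ denoting the spectral radius, for every $n$ and every $t>0$, $$\mathbb P\bigl(\rho(A_n)\ge \underline\sigma_n(1+t\sigma_*)\bigr)\le C_0\,n\,e^{-c\,\underline\sigma_n t}.$$ (So if $\underline\sigma_n\ge s$ for a constant $s>0$, in particular if $\underline\sigma$ does not depend on $n$ and $s=\underline\sigma$, the bound is $C_0ne^{-Ct}$ with $C=cs$ depending only on $K$, $L$ and $s$.) In particular, almost surely $\limsup_{n\to\infty}(\rho(A_n)-\underline\sigma_n)\le 0$ and $\limsup_{n\to\infty}\rho(A_n)\le\limsup_{n\to\infty}\underline\sigma_n$; when $\underline\sigma$ does not depend on $n$ this says $\mathbb P(\limsup_{n\to\infty}\rho(A_n)\le\underline\sigma)=1$. -/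

import Mathlib

open MeasureTheory ProbabilityTheory Filter Asymptotics
open scoped ENNReal Topology

/-- The array `x = (x_ij)` consists of independent complex random variables with mean zero, unit
variance and the sub-exponential moment bounds `𝔼|x_ij|^m ≤ (K m)^m` for all `m ≥ 1`.
The entries need be neither identically nor symmetrically distributed; real entries are the special
case of entries whose imaginary part vanishes. -/
structure IsSubexponentialArray {Ω : Type*} [MeasurableSpace Ω] (μ : Measure Ω) (K : ℝ) {n : ℕ}
    (x : Fin n → Fin n → Ω → ℂ) : Prop where
  measurable : ∀ i j, Measurable (x i j)
  indep : iIndepFun (fun p : Fin n × Fin n => x p.1 p.2) μ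
  mean_zero : ∀ i j, ∫ ω, x i j ω ∂μ = 0
  variance_one : ∀ i j, ∫ ω, ‖x i j ω‖ ^ 2 ∂μ = 1
  integrable_moment : ∀ i j, ∀ m : ℕ, 1 ≤ m → Integrable (fun ω => ‖x i j ω‖ ^ m) μ
  moment_le : ∀ i j, ∀ m : ℕ, 1 ≤ m → ∫ ω, ‖x i j ω‖ ^ m ∂μ ≤ (K * m) ^ m

/-- The random matrix `A = (b_ij x_ij)`, at the sample point `ω`. -/
def inhomogeneousMatrix {Ω : Type*} {n : ℕ} (b : Matrix (Fin n) (Fin n) ℝ)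
    (x : Fin n → Fin n → Ω → ℂ) (ω : Ω) : Matrix (Fin n) (Fin n) ℂ :=
  Matrix.of fun i j => (b i j : ℂ) * x i j ω

/-- The variance matrix `S = (b_ij ^ 2)`. -/
def varianceMatrix {n : ℕ} (b : Matrix (Fin n) (Fin n) ℝ) : Matrix (Fin n) (Fin n) ℝ :=
  Matrix.of fun i j => b i j ^ 2

/-- The sparsity parameter `σ_* = sup_{i,j} b_ij` (a maximum over finitely many entries). -/
noncomputable def sparsity {n : ℕ} (b : Matrix (Fin n) (Fin n) ℝ) : ℝ :=
  ⨆ p : Fin n × Fin n, b p.1 p.2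

/-- `S` is long-time controlled by `σ` with constant `L`: for all `k ≥ 1`, every row sum of `S ^ k`
and every row sum of `(Sᵀ) ^ k` is at most `L * σ ^ (2 * k)`. -/
def LongTimeControlled {n : ℕ} (S : Matrix (Fin n) (Fin n) ℝ) (L σ : ℝ) : Prop :=
  ∀ k : ℕ, 1 ≤ k →
    (∀ i, ∑ j, (S ^ k) i j ≤ L * σ ^ (2 * k)) ∧
    (∀ i, ∑ j, (S.transpose ^ k) i j ≤ L * σ ^ (2 * k))

/-! ### Pairs of walks

A sequence of labels `w : ℕ → V` is read as a pair of walks with `k` steps each: the first one visits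
the labels at the times `0, …, k`, the second one those at the times `k + 1, …, 2 k + 1`. The step at
time `k` is a jump to the starting point and is not counted as a step. -/

/-! Since the Frobenius norm gives `ρ(A)^(2k) ≤ ‖A^k‖²`, it suffices to prove `𝔼‖A^k‖² ≤ C n σ^(2k)`
for `k` up to order `σ/σ_*`. Markov's inequality with `k` of that order yields the tail `C n
e^(-cσt)`. Borel–Cantelli with `t` of order `log n / σ` then gives the almost sure bounds, with an
error of order `σ_* log n → 0`.

Rescale to `σ = 1`, so that the entries of `b` are at most `δ = σ_*/σ`. The expected norm is a sum
over pairs of walks; by independence and centring only the pairs that use every directed edge at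
least twice survive (`norm_integral_prod_le`). The moment bound of an edge is split among its
traversals: `b²` for the first, `1` for the second, `bΘr` for one preceded by `r ≥ 2` others.

Each surviving pair is read as a trajectory. Typically it discovers labels along fresh edges and
later retraces them, and at an ordinary second visit the next step is forced up to one bit.
Exceptions come from new edges between known labels (factor `δ²`) and from third traversals (factor
`δ`); all ambiguities are counted by these (`Good.card_decision_le`, `Good.card_branching_le`,
`Good.prod_openEdges_le`, `Good.prod_departures_le`). A code records the number of third steps, the
times of the new ones, their targets and the branching labels. Given the code, the weight is at most
an explicit loss times a product of transition kernels.

Long-time control enters in `sum_kernel_le`: a run of fresh steps lasts until a time fixed by the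
code, so it contributes a row sum of a power of `S`, at most `L` whatever its length. Hence each
code has total kernel weight at most `nL`, and the sum of losses over codes is geometric once `kδ`
is small (`sum_codes_le`). -/

namespace WalkPair

section Basic

variable {V : Type*} [DecidableEq V]

/-- The times of the genuine steps of a pair of walks of length `k`. -/
def steps (k : ℕ) : Finset ℕ := (Finset.range (2 * k + 1)).erase k

/-- The number of times that the edge `(u, v)` is traversed before time `τ`. -/
def traversals (k : ℕ) (w : ℕ → V) (τ : ℕ) (u v : V) : ℕ :=
  ((Finset.range τ).filter fun σ => σ ≠ k ∧ w σ = u ∧ w (σ + 1) = v).card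

/-- The number of earlier traversals of the edge used at time `τ`. -/
def count (k : ℕ) (w : ℕ → V) (τ : ℕ) : ℕ := traversals k w τ (w τ) (w (τ + 1))

/-- The label at time `τ` has not been visited before. -/
def Fresh (w : ℕ → V) (τ : ℕ) : Prop := ∀ σ < τ, w σ ≠ w τ

instance (w : ℕ → V) : DecidablePred (Fresh w) := fun τ => by unfold Fresh; infer_instance

/-- The time of the first visit to the label at time `τ`. -/
def firstVisit (w : ℕ → V) (τ : ℕ) : ℕ := Nat.find (p := fun σ => w σ = w τ) ⟨τ, rfl⟩

/-- The number of earlier visits to the label at time `τ`. -/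
def visits (w : ℕ → V) (τ : ℕ) : ℕ := ((Finset.range τ).filter fun σ => w σ = w τ).card

/-- The number of earlier departures from the label at time `τ`. -/
def departures (k : ℕ) (w : ℕ → V) (τ : ℕ) : ℕ :=
  ((Finset.range τ).filter fun σ => σ ≠ k ∧ w σ = w τ).card

/-- Steps to a label that has not been visited before. -/
def freshSteps (k : ℕ) (w : ℕ → V) : Finset ℕ := (steps k).filter fun τ => Fresh w (τ + 1)

/-- Steps along a new edge to a label visited before. -/
def newSteps (k : ℕ) (w : ℕ → V) : Finset ℕ :=
  (steps k).filter fun τ => ¬ Fresh w (τ + 1) ∧ count k w τ = 0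

/-- First visits to the endpoints of the new steps. -/
def marked (k : ℕ) (w : ℕ → V) : Finset ℕ := (newSteps k w).image fun σ => firstVisit w (σ + 1)

/-- Second traversals of an edge. -/
def secondSteps (k : ℕ) (w : ℕ → V) : Finset ℕ := (steps k).filter fun τ => count k w τ = 1

/-- Third and later traversals of an edge. -/
def thirdSteps (k : ℕ) (w : ℕ → V) : Finset ℕ := (steps k).filter fun τ => 2 ≤ count k w τ

/-- The second walk starts where the first one does, and every edge is traversed at least twice. -/
structure Good (k : ℕ) (w : ℕ → V) : Prop where
  jump : w (k + 1) = w 0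
  two_le : ∀ τ ∈ steps k, 2 ≤ traversals k w (2 * k + 1) (w τ) (w (τ + 1))

variable {k : ℕ} {w : ℕ → V} {τ σ : ℕ} {u v : V}

lemma mem_steps : τ ∈ steps k ↔ τ ≠ k ∧ τ < 2 * k + 1 := by
  simp [steps]

lemma traversals_succ (k : ℕ) (w : ℕ → V) (τ : ℕ) (u v : V) :
    traversals k w (τ + 1) u v =
      traversals k w τ u v + if τ ≠ k ∧ w τ = u ∧ w (τ + 1) = v then 1 else 0 := by
  unfold traversals
  rw [Finset.range_add_one, Finset.filter_insert]
  split_ifs with h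
  · rw [Finset.card_insert_of_notMem (by simp)]
  · rfl

lemma traversals_mono (k : ℕ) (w : ℕ → V) (u v : V) (h : σ ≤ τ) :
    traversals k w σ u v ≤ traversals k w τ u v :=
  Finset.card_le_card (Finset.filter_subset_filter _ (Finset.range_mono h))

lemma count_lt_traversals (h : τ ≠ k) (hστ : τ < σ) :
    count k w τ < traversals k w σ (w τ) (w (τ + 1)) := by
  have := traversals_mono k w (w τ) (w (τ + 1)) (Nat.succ_le_of_lt hστ)
  rw [Nat.succ_eq_add_one, traversals_succ, if_pos ⟨h, rfl, rfl⟩] at this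
  exact this

/-- The number of traversals grows by at most one per unit of time, so no value is skipped. -/
lemma exists_step {j M : ℕ} (h : j < traversals k w M u v) :
    ∃ τ < M, τ ≠ k ∧ w τ = u ∧ w (τ + 1) = v ∧ count k w τ = j := by
  induction M with
  | zero => simp [traversals] at h
  | succ M ih =>
    by_cases h' : j < traversals k w M u v
    · obtain ⟨τ, h1, h2⟩ := ih h'
      exact ⟨τ, by omega, h2⟩
    · rw [traversals_succ] at h
      split_ifs at h with hM
      · refine ⟨M, by omega, hM.1, hM.2.1, hM.2.2, ?_⟩
        unfold count
        rw [hM.2.1, hM.2.2]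
        omega
      · omega

/-- An edge together with the rank of the traversal identifies the step. The injections in the
counting lemmas below rest on this. -/
lemma eq_of_count_eq (hτ : τ ≠ k) (hσ : σ ≠ k) (h1 : w τ = w σ) (h2 : w (τ + 1) = w (σ + 1))
    (h : count k w τ = count k w σ) : τ = σ := by
  rcases lt_trichotomy τ σ with hlt | heq | hlt
  · have := count_lt_traversals (w := w) hτ hlt
    rw [h1, h2] at this
    exact absurd h (ne_of_lt this)
  · exact heq
  · have := count_lt_traversals (w := w) hσ hlt
    rw [← h1, ← h2] at this
    exact absurd h.symm (ne_of_lt this)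

lemma firstVisit_spec (w : ℕ → V) (τ : ℕ) : w (firstVisit w τ) = w τ :=
  Nat.find_spec (p := fun σ => w σ = w τ) ⟨τ, rfl⟩

lemma firstVisit_le (h : w σ = w τ) : firstVisit w τ ≤ σ := Nat.find_min' _ h

lemma firstVisit_le_self (w : ℕ → V) (τ : ℕ) : firstVisit w τ ≤ τ := firstVisit_le rfl

lemma firstVisit_eq_of_eq (h : w σ = w τ) : firstVisit w σ = firstVisit w τ :=
  le_antisymm (firstVisit_le ((firstVisit_spec w τ).trans h.symm))
    (firstVisit_le ((firstVisit_spec w σ).trans h))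

lemma firstVisit_eq_iff : firstVisit w σ = firstVisit w τ ↔ w σ = w τ :=
  ⟨fun h => by rw [← firstVisit_spec w σ, h, firstVisit_spec w τ], firstVisit_eq_of_eq⟩

lemma fresh_firstVisit (w : ℕ → V) (τ : ℕ) : Fresh w (firstVisit w τ) := fun _ hσ h =>
  absurd (firstVisit_le (h.trans (firstVisit_spec w τ))) (not_le.2 hσ)

lemma Fresh.firstVisit_eq (h : Fresh w τ) : firstVisit w τ = τ := by
  by_contra hne
  exact h _ (lt_of_le_of_ne (firstVisit_le_self w τ) hne) (firstVisit_spec w τ)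

lemma fresh_iff : Fresh w τ ↔ firstVisit w τ = τ :=
  ⟨Fresh.firstVisit_eq, fun h => h ▸ fresh_firstVisit w τ⟩

lemma firstVisit_lt (h : ¬ Fresh w τ) : firstVisit w τ < τ :=
  lt_of_le_of_ne (firstVisit_le_self w τ) fun h' => h (fresh_iff.2 h')

lemma fresh_zero (w : ℕ → V) : Fresh w 0 := fun _ hσ => absurd hσ (Nat.not_lt_zero _)

lemma Fresh.eq (hσ : Fresh w σ) (hτ : Fresh w τ) (h : w σ = w τ) : σ = τ := by
  rw [← hσ.firstVisit_eq, ← hτ.firstVisit_eq, firstVisit_eq_iff.2 h]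

lemma Fresh.traversals_left (h : Fresh w τ) (v : V) : traversals k w τ (w τ) v = 0 := by
  unfold traversals
  rw [Finset.card_eq_zero, Finset.filter_eq_empty_iff]
  intro σ hσ h'
  exact h σ (Finset.mem_range.1 hσ) h'.2.1

lemma Fresh.traversals_right (h : Fresh w (τ + 1)) (u : V) :
    traversals k w τ u (w (τ + 1)) = 0 := by
  unfold traversals
  rw [Finset.card_eq_zero, Finset.filter_eq_empty_iff]
  intro σ hσ h'
  exact h (σ + 1) (by simpa using hσ) h'.2.2

lemma Fresh.count_eq_zero (h : Fresh w (τ + 1)) : count k w τ = 0 := h.traversals_right _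

lemma mem_freshSteps : τ ∈ freshSteps k w ↔ τ ∈ steps k ∧ Fresh w (τ + 1) := Finset.mem_filter

lemma mem_newSteps :
    τ ∈ newSteps k w ↔ τ ∈ steps k ∧ ¬ Fresh w (τ + 1) ∧ count k w τ = 0 := Finset.mem_filter

lemma mem_secondSteps : τ ∈ secondSteps k w ↔ τ ∈ steps k ∧ count k w τ = 1 := Finset.mem_filter

lemma mem_thirdSteps : τ ∈ thirdSteps k w ↔ τ ∈ steps k ∧ 2 ≤ count k w τ := Finset.mem_filter

/-- Every step is of one of the four types. -/
lemma step_cases (h : τ ∈ steps k) : τ ∈ freshSteps k w ∨ τ ∈ newSteps k w ∨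
    τ ∈ secondSteps k w ∨ τ ∈ thirdSteps k w := by
  simp only [mem_freshSteps, mem_newSteps, mem_secondSteps, mem_thirdSteps, h, true_and]
  have : count k w τ = 0 ∨ count k w τ = 1 ∨ 2 ≤ count k w τ := by omega
  tauto

lemma count_eq_zero_iff (h : τ ∈ steps k) :
    count k w τ = 0 ↔ τ ∈ freshSteps k w ∨ τ ∈ newSteps k w := by
  simp only [mem_freshSteps, mem_newSteps, h, true_and]
  have := fun h : Fresh w (τ + 1) => h.count_eq_zero (k := k)
  tauto

lemma disjoint_freshSteps_newSteps : Disjoint (freshSteps k w) (newSteps k w) := by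
  rw [Finset.disjoint_left]
  intro τ h1 h2
  exact (mem_newSteps.1 h2).2.1 (mem_freshSteps.1 h1).2

/-- The step that traverses the same edge as `τ` for the first time. -/
lemma exists_first (h : τ ∈ steps k) : ∃ σ ∈ steps k, σ ≤ τ ∧ w σ = w τ ∧ w (σ + 1) = w (τ + 1) ∧
    count k w σ = 0 := by
  rw [mem_steps] at h
  obtain ⟨σ, h1, h2, h3, h4, h5⟩ := exists_step (k := k) (w := w) (j := 0) (M := τ + 1)
    (u := w τ) (v := w (τ + 1)) ((Nat.zero_le _).trans_lt (count_lt_traversals h.1 (Nat.lt_succ_self τ)))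
  exact ⟨σ, mem_steps.2 ⟨h2, by omega⟩, by omega, h3, h4, h5⟩

/-- Every edge of a good pair of walks has a second traversal. -/
lemma Good.exists_second (hw : Good k w) (h : τ ∈ steps k) :
    ∃ σ ∈ secondSteps k w, w σ = w τ ∧ w (σ + 1) = w (τ + 1) := by
  obtain ⟨σ, h1, h2, h3, h4, h5⟩ := exists_step (j := 1) (hw.two_le τ h)
  exact ⟨σ, mem_secondSteps.2 ⟨mem_steps.2 ⟨h2, h1⟩, h5⟩, h3, h4⟩

lemma Good.firstVisit_jump (hw : Good k w) : firstVisit w (k + 1) = 0 :=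
  Nat.le_zero.1 (firstVisit_le hw.jump.symm)

/-- A visit to a label other than the starting point is reached by a step. -/
lemma Good.pred_mem_steps (hw : Good k w) (hτ : τ ≤ 2 * k + 1) (h0 : firstVisit w τ ≠ 0) :
    ∃ σ ∈ steps k, τ = σ + 1 := by
  have h1 : τ ≠ 0 := by
    rintro rfl
    exact h0 (fresh_zero w).firstVisit_eq
  have h2 : τ ≠ k + 1 := by
    rintro rfl
    exact h0 hw.firstVisit_jump
  exact ⟨τ - 1, mem_steps.2 ⟨by omega, by omega⟩, by omega⟩

/-- All steps into a label that is not the starting point and not the endpoint of a new step use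
the same edge. -/
lemma exists_freshStep_of_unmarked (hτ : τ ∈ steps k)
    (hN : firstVisit w (τ + 1) ∉ marked k w) :
    ∃ σ ∈ steps k, σ ≤ τ ∧ firstVisit w (τ + 1) = σ + 1 ∧ w σ = w τ ∧ w (σ + 1) = w (τ + 1) := by
  obtain ⟨σ, h1, h2, h3, h4, h5⟩ := exists_first (w := w) hτ
  rcases (count_eq_zero_iff h1).1 h5 with h | h
  · refine ⟨σ, h1, h2, ?_, h3, h4⟩
    rw [← firstVisit_eq_iff.2 h4]
    exact (mem_freshSteps.1 h).2.firstVisit_eq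
  · have h6 : firstVisit w (σ + 1) = firstVisit w (τ + 1) := firstVisit_eq_of_eq h4
    exact absurd (h6 ▸ Finset.mem_image_of_mem (fun σ => firstVisit w (σ + 1)) h) hN

/-- A third visit to an unmarked label comes from a third traversal. -/
lemma Good.third_of_unmarked (hw : Good k w) (hτ : τ ∈ steps k)
    (h0 : firstVisit w (τ + 1) ≠ 0)
    (hN : firstVisit w (τ + 1) ∉ marked k w)
    (h2 : firstVisit w (τ + 1) < σ) (h3 : σ < τ + 1) (h4 : w σ = w (τ + 1)) :
    τ ∈ thirdSteps k w := by
  obtain ⟨a, ha, haτ, ha1, ha2, ha3⟩ := exists_freshStep_of_unmarked hτ hN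
  have hσ : firstVisit w σ = firstVisit w (τ + 1) := firstVisit_eq_iff.2 h4
  have hτ' := mem_steps.1 hτ
  obtain ⟨b, hb, rfl⟩ := hw.pred_mem_steps (τ := σ) (by omega) (by rw [hσ]; exact h0)
  obtain ⟨c, hc, hcb, hc1, hc2, hc3⟩ := exists_freshStep_of_unmarked hb
    (by rw [hσ]; exact hN)
  -- The steps `b` and `τ` both repeat the edge of the step `a` that discovered the label, and `a <
  -- b < τ`.
  have hca : c = a := by omega
  subst hca
  have hab : c < b := by omega
  have h5 := count_lt_traversals (k := k) (w := w) (mem_steps.1 ha).1 hab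
  rw [hc2, hc3] at h5
  have h6 := count_lt_traversals (k := k) (w := w) (σ := τ) (mem_steps.1 hb).1 (by omega)
  have h7 : count k w b < count k w τ := by
    unfold count at h6 ⊢
    rw [← hc2, ← hc3] at h6
    rw [← hc2, ← hc3]
    rwa [ha2, ha3] at h6 ⊢
  have h8 : 0 < count k w b := (Nat.zero_le _).trans_lt h5
  exact mem_thirdSteps.2 ⟨hτ, by omega⟩

end Basic

end WalkPair

/-! ### Combinatorics of good pairs: counting the exceptional steps -/

namespace WalkPair

section Counting

/-- Counted from the largest element down, the factors are `2, 3, …, s.card + 1`. -/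
lemma prod_one_add_card_ge (s : Finset ℕ) :
    ∏ a ∈ s, (1 + (s.filter fun b => a ≤ b).card) = (s.card + 1).factorial := by
  induction s using Finset.induction_on_min with
  | empty => simp
  | insert a s ha ih =>
    have hnot : a ∉ s := fun h => lt_irrefl _ (ha a h)
    rw [Finset.prod_insert hnot, Finset.card_insert_of_notMem hnot, Nat.factorial_succ]
    congr 1
    · rw [Finset.filter_true_of_mem, Finset.card_insert_of_notMem hnot]
      · ring
      · intro b hb
        rcases Finset.mem_insert.1 hb with rfl | h
        · exact le_rfl
        · exact (ha b h).le
    · rw [← ih]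
      refine Finset.prod_congr rfl fun b hb => ?_
      rw [Finset.filter_insert, if_neg (not_le.2 (ha b hb))]

lemma prod_add_card_lt (c : ℕ) (s : Finset ℕ) :
    ∏ a ∈ s, (c + (s.filter fun b => b < a).card) = c.ascFactorial s.card := by
  induction s using Finset.induction_on_max with
  | empty => simp
  | insert a s ha ih =>
    have hnot : a ∉ s := fun h => lt_irrefl _ (ha a h)
    rw [Finset.prod_insert hnot, Finset.card_insert_of_notMem hnot, Nat.ascFactorial_succ]
    congr 1
    · rw [Finset.filter_insert, if_neg (lt_irrefl a), Finset.filter_true_of_mem ha]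
    · rw [← ih]
      refine Finset.prod_congr rfl fun b hb => ?_
      rw [Finset.filter_insert, if_neg (not_lt.2 (ha b hb).le)]

variable {V : Type*} [DecidableEq V]

/-- The times at which the type of the next step is not determined by the past. -/
def Decision (k : ℕ) (Y : Finset ℕ) (w : ℕ → V) (τ : ℕ) : Prop :=
  -- The times `0` and `k` are special because of the jump: it revisits the starting label without a
  -- step, and no step departs at time `k`. The condition `visits w τ ≠ 1` excludes second visits.
  firstVisit w τ ∈ Y ∨ firstVisit w τ = 0 ∨ firstVisit w τ = k ∨ visits w τ ≠ 1

instance (k : ℕ) (Y : Finset ℕ) (w : ℕ → V) : DecidablePred (Decision k Y w) := fun τ => by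
  unfold Decision; infer_instance

/-- First visits to the labels at which a fresh step departs at the second, unmarked visit. -/
def branching (k : ℕ) (w : ℕ → V) : Finset ℕ :=
  ((freshSteps k w).filter fun τ => ¬ Fresh w τ ∧ ¬ Decision k (marked k w) w τ).image
    (firstVisit w)

/-- Second steps followed by a later second step from the same label. -/
def extraSteps (k : ℕ) (w : ℕ → V) : Finset ℕ :=
  (secondSteps k w).filter fun τ => ∃ σ ∈ secondSteps k w, τ < σ ∧ w σ = w τ

/-- The number of edges out of the label at time `τ` that have been traversed exactly once. -/
def openEdges [Fintype V] (k : ℕ) (w : ℕ → V) (τ : ℕ) : ℕ :=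
  (Finset.univ.filter fun v => traversals k w τ (w τ) v = 1).card

variable {k : ℕ} {w : ℕ → V} {τ σ : ℕ} {u v : V}

lemma two_le_visits {a b : ℕ} (h1 : a < b) (h2 : b < τ) (ha : w a = w τ) (hb : w b = w τ) :
    2 ≤ visits w τ := by
  unfold visits
  have : ({a, b} : Finset ℕ) ⊆ (Finset.range τ).filter fun σ => w σ = w τ := by
    intro x hx
    rcases Finset.mem_insert.1 hx with rfl | hx
    · simp [ha]; omega
    · rw [Finset.mem_singleton.1 hx]; simp [hb]; omega
  simpa [Finset.card_pair h1.ne] using Finset.card_le_card this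

lemma visits_pos (h : ¬ Fresh w τ) : 0 < visits w τ := by
  unfold visits
  rw [Finset.card_pos]
  exact ⟨firstVisit w τ, by simp [firstVisit_lt h, firstVisit_spec]⟩

lemma exists_visit_of_two_le (h : 2 ≤ visits w τ) :
    ∃ σ, firstVisit w τ < σ ∧ σ < τ ∧ w σ = w τ := by
  unfold visits at h
  obtain ⟨σ, hσ, hne⟩ := Finset.exists_mem_ne (Nat.lt_of_succ_le h) (firstVisit w τ)
  simp only [Finset.mem_filter, Finset.mem_range] at hσ
  exact ⟨σ, lt_of_le_of_ne (firstVisit_le hσ.2) hne.symm, hσ.1, hσ.2⟩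

lemma exists_departures_of_two_le (h : 2 ≤ traversals k w τ u v) :
    ∃ a b, a < b ∧ b < τ ∧ w a = u ∧ w b = u := by
  unfold traversals at h
  obtain ⟨a, ha, b, hb, hab⟩ := Finset.one_lt_card.1 (show 1 < _ from h)
  simp only [Finset.mem_filter, Finset.mem_range] at ha hb
  rcases lt_or_gt_of_ne hab with h | h
  · exact ⟨a, b, h, hb.1, ha.2.2.1, hb.2.2.1⟩
  · exact ⟨b, a, h, ha.1, hb.2.2.1, ha.2.2.1⟩

/-- A step that departs from a fresh label is new. -/
lemma fresh_departure (hτ : τ ∈ steps k) (hN : τ ∉ newSteps k w) (hf : Fresh w τ) :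
    τ ∈ freshSteps k w :=
  ((count_eq_zero_iff hτ).1 (hf.traversals_left _)).resolve_right hN

/-- A third traversal needs two earlier departures, so it cannot start at a second visit. -/
lemma not_third_of_not_decision {Y : Finset ℕ} (hd : ¬ Decision k Y w τ) :
    τ ∉ thirdSteps k w := fun h => by
  obtain ⟨a, b, h1, h2, h3, h4⟩ := exists_departures_of_two_le (mem_thirdSteps.1 h).2
  have := two_le_visits h1 h2 h3 h4
  unfold Decision at hd
  omega

/-- An unmarked second visit is determined by its label. -/
lemma eq_of_not_decision {Y : Finset ℕ} (h1 : ¬ Decision k Y w τ) (h2 : ¬ Decision k Y w σ)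
    (f1 : ¬ Fresh w τ) (f2 : ¬ Fresh w σ) (h : firstVisit w τ = firstVisit w σ) : τ = σ := by
  wlog hlt : τ < σ generalizing τ σ
  · rcases (not_lt.1 hlt).lt_or_eq with h' | h'
    · exact (this h2 h1 f2 f1 h.symm h').symm
    · exact h'.symm
  have h3 := firstVisit_lt f1
  have h4 := firstVisit_eq_iff.1 h
  have := two_le_visits h3 hlt ((firstVisit_spec w τ).trans h4) h4
  unfold Decision at h2
  omega

/-- One bit per label settles the step at an ordinary second visit; the set `branching` stores these
bits. -/
lemma not_decision_cases (hτ : τ ∈ steps k) (hN : τ ∉ newSteps k w) (hf : ¬ Fresh w τ)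
    (hd : ¬ Decision k (marked k w) w τ) :
    (τ ∈ freshSteps k w ∧ firstVisit w τ ∈ branching k w) ∨
      (τ ∈ secondSteps k w ∧ firstVisit w τ ∉ branching k w) := by
  rcases step_cases (w := w) hτ with h | h | h | h
  · exact Or.inl ⟨h, Finset.mem_image_of_mem _ (Finset.mem_filter.2 ⟨h, hf, hd⟩)⟩
  · exact absurd h hN
  · refine Or.inr ⟨h, fun hb => ?_⟩
    obtain ⟨σ, hσ, hσ'⟩ := Finset.mem_image.1 hb
    rw [Finset.mem_filter] at hσ
    have := eq_of_not_decision hσ.2.2 hd hσ.2.1 hf hσ'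
    subst this
    have h1 := (mem_secondSteps.1 h).2
    have h2 := (mem_freshSteps.1 hσ.1).2.count_eq_zero (k := k)
    omega
  · exact absurd h (not_third_of_not_decision hd)

/-- If the second visit is left by a fresh step, the edge taken at the first visit must still be
repeated. This requires a third visit, and an unmarked label is reached for the third time only by a
third traversal. -/
lemma Good.card_branching_le (hw : Good k w) :
    (branching k w).card ≤ (thirdSteps k w).card := by
  refine le_trans (Finset.card_le_card (t := (thirdSteps k w).image fun τ => firstVisit w (τ + 1))
    ?_) Finset.card_image_le
  intro f hf
  obtain ⟨τ, hτ, rfl⟩ := Finset.mem_image.1 hf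
  rw [Finset.mem_filter] at hτ
  obtain ⟨hF, hnf, hd⟩ := hτ
  have hτs := (mem_freshSteps.1 hF).1
  have hτs' := mem_steps.1 hτs
  have hlt := firstVisit_lt hnf
  have hfk : firstVisit w τ ≠ k := by unfold Decision at hd; tauto
  have hf0 : firstVisit w τ ≠ 0 := by unfold Decision at hd; tauto
  have hfs : firstVisit w τ ∈ steps k := mem_steps.2 ⟨hfk, by omega⟩
  set f := firstVisit w τ with hfdef
  have hwf : w f = w τ := firstVisit_spec w τ
  obtain ⟨g, hg, hgk, hg1, hg2, hg3⟩ := exists_step (j := 1) (hw.two_le f hfs)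
  have hfc : count k w f = 0 := (fresh_firstVisit w τ).traversals_left _
  have hgf : f < g := by
    refine lt_of_le_of_ne (firstVisit_le (hg1.trans hwf)) ?_
    rintro h
    rw [← h] at hg3
    omega
  have hgτ : g ≠ τ := by
    rintro rfl
    refine (mem_freshSteps.1 hF).2 (f + 1) (by omega) hg2.symm
  have hτg : τ < g := by
    by_contra hcon
    have := two_le_visits (w := w) (τ := τ) hgf (by omega) hwf (hg1.trans hwf)
    unfold Decision at hd
    omega
  have hwg : firstVisit w g = f := firstVisit_eq_of_eq (hg1.trans hwf)
  obtain ⟨b, hb, rfl⟩ := hw.pred_mem_steps (τ := g) (by omega) (by omega)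
  refine Finset.mem_image.2 ⟨b, ?_, hwg⟩
  refine hw.third_of_unmarked (σ := τ) hb (by omega) ?_ (by omega) hτg (hwf.symm.trans hg1.symm)
  rw [hwg]
  unfold Decision at hd
  tauto

/-- A decision is charged to the step arriving there: a new step, a third step, or a second step
into a marked label or into the label at time `0` or `k`. Only time `k + 1` has no arriving step. A
second step of this kind is charged in turn to the first traversal of its edge, which is new or
discovers that label. -/
lemma Good.card_decision_le (hw : Good k w) :
    ((steps k \ newSteps k w).filter fun τ => ¬ Fresh w τ ∧ Decision k (marked k w) w τ).card ≤
      3 * (newSteps k w).card + (thirdSteps k w).card + 3 := by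
  set R := (secondSteps k w).filter fun τ =>
    firstVisit w (τ + 1) ∈ insert 0 (insert k (marked k w)) with hR
  have h1 : ((steps k \ newSteps k w).filter fun τ =>
      ¬ Fresh w τ ∧ Decision k (marked k w) w τ) ⊆
      insert (k + 1) ((newSteps k w ∪ thirdSteps k w ∪ R).image (· + 1)) := by
    intro τ hτ
    simp only [Finset.mem_filter, Finset.mem_sdiff] at hτ
    obtain ⟨⟨hs, hN⟩, hf, hd⟩ := hτ
    by_cases hk : τ = k + 1
    · simp [hk]
    refine Finset.mem_insert_of_mem ?_
    have h0 : τ ≠ 0 := by rintro rfl; exact hf (fresh_zero w)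
    obtain ⟨b, rfl⟩ : ∃ b, τ = b + 1 := ⟨τ - 1, by omega⟩
    have hs' := mem_steps.1 hs
    have hb : b ∈ steps k := mem_steps.2 ⟨by omega, by omega⟩
    refine Finset.mem_image_of_mem (· + 1) ?_
    rcases step_cases (w := w) hb with h | h | h | h
    · exact absurd (mem_freshSteps.1 h).2 hf
    · simp [h]
    · by_cases hin : firstVisit w (b + 1) ∈ insert 0 (insert k (marked k w))
      · simp only [Finset.mem_union]
        exact Or.inr (Finset.mem_filter.2 ⟨h, hin⟩)
      · simp only [Finset.mem_insert, not_or] at hin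
        have hv : 2 ≤ visits w (b + 1) := by
          have := visits_pos hf
          unfold Decision at hd
          have : visits w (b + 1) ≠ 1 := by tauto
          omega
        obtain ⟨σ, hσ1, hσ2, hσ3⟩ := exists_visit_of_two_le hv
        simp [hw.third_of_unmarked hb hin.1 hin.2.2 hσ1 hσ2 hσ3]
    · simp [h]
  have h2 : R.card ≤ 2 * (newSteps k w).card + 2 := by
    have hex : ∀ τ ∈ R, ∃ σ ∈ steps k, w σ = w τ ∧ w (σ + 1) = w (τ + 1) ∧ count k w σ = 0 :=
      fun τ hτ => by
        obtain ⟨σ, h1, h2, h3⟩ := exists_first (w := w)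
          (mem_secondSteps.1 (Finset.mem_filter.1 hτ).1).1
        exact ⟨σ, h1, h3⟩
    choose! f hf1 hf2 hf3 hf4 using hex
    have hmaps : ∀ τ ∈ R, f τ + 1 ∈ (newSteps k w).image (· + 1) ∪ insert 0 (insert k (marked k w)) := by
      intro τ hτ
      rcases (count_eq_zero_iff (hf1 τ hτ)).1 (hf4 τ hτ) with h | h
      · have h3 : firstVisit w (τ + 1) = f τ + 1 := by
          rw [← (mem_freshSteps.1 h).2.firstVisit_eq]
          exact firstVisit_eq_of_eq (hf3 τ hτ).symm
        rw [← h3]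
        exact Finset.mem_union_right _ (Finset.mem_filter.1 hτ).2
      · exact Finset.mem_union_left _ (Finset.mem_image_of_mem _ h)
    have hinj : Set.InjOn (fun τ => f τ + 1) R := by
      intro a ha b hb hab
      have hab' : f a = f b := by simpa using hab
      have ha2 := mem_secondSteps.1 (Finset.mem_filter.1 ha).1
      have hb2 := mem_secondSteps.1 (Finset.mem_filter.1 hb).1
      refine eq_of_count_eq (k := k) (w := w) (mem_steps.1 ha2.1).1 (mem_steps.1 hb2.1).1
        ?_ ?_ (ha2.2.trans hb2.2.symm)
      · rw [← hf2 a ha, ← hf2 b hb, hab']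
      · rw [← hf3 a ha, ← hf3 b hb, hab']
    have hY : (marked k w).card ≤ (newSteps k w).card := Finset.card_image_le
    calc R.card ≤ ((newSteps k w).image (· + 1) ∪ insert 0 (insert k (marked k w))).card :=
          Finset.card_le_card_of_injOn _ hmaps hinj
      _ ≤ (newSteps k w).card + ((marked k w).card + 1 + 1) := by
          refine (Finset.card_union_le _ _).trans (add_le_add Finset.card_image_le ?_)
          exact (Finset.card_insert_le _ _).trans
            (Nat.succ_le_succ (Finset.card_insert_le _ _))
      _ ≤ _ := by omega
  refine (Finset.card_le_card h1).trans ((Finset.card_insert_le _ _).trans ?_)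
  have h3 := (Finset.card_image_le (f := (· + 1)) (s := newSteps k w ∪ thirdSteps k w ∪ R))
  have h4 := Finset.card_union_le (newSteps k w ∪ thirdSteps k w) R
  have h5 := Finset.card_union_le (newSteps k w) (thirdSteps k w)
  omega

lemma Good.card_secondSteps_le :
    (secondSteps k w).card ≤ (freshSteps k w).card + (newSteps k w).card := by
  have hex : ∀ τ ∈ secondSteps k w, ∃ σ ∈ steps k,
      w σ = w τ ∧ w (σ + 1) = w (τ + 1) ∧ count k w σ = 0 := fun τ hτ => by
    obtain ⟨σ, h1, h2, h3⟩ := exists_first (w := w) (mem_secondSteps.1 hτ).1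
    exact ⟨σ, h1, h3⟩
  choose! f hf1 hf2 hf3 hf4 using hex
  rw [← Finset.card_union_of_disjoint disjoint_freshSteps_newSteps]
  refine Finset.card_le_card_of_injOn f (fun τ hτ => ?_) (fun a ha b hb hab => ?_)
  · exact Finset.mem_union.2 ((count_eq_zero_iff (hf1 τ hτ)).1 (hf4 τ hτ))
  · have ha2 := mem_secondSteps.1 ha
    have hb2 := mem_secondSteps.1 hb
    refine eq_of_count_eq (k := k) (w := w) (mem_steps.1 ha2.1).1 (mem_steps.1 hb2.1).1
      ?_ ?_ (ha2.2.trans hb2.2.symm)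
    · rw [← hf2 a ha, ← hf2 b hb, hab]
    · rw [← hf3 a ha, ← hf3 b hb, hab]

/-- A discovered label other than the two final ones is left again, along an edge that has a second
traversal; the last second step out of that label is not extra. -/
lemma Good.card_freshSteps_le (hw : Good k w) :
    (freshSteps k w).card ≤ ((secondSteps k w) \ (extraSteps k w)).card + 2 := by
  set F := (freshSteps k w).filter fun τ => w (τ + 1) ≠ w k ∧ w (τ + 1) ≠ w (2 * k + 1) with hF
  have h1 : (freshSteps k w).card ≤ F.card + 2 := by
    have : freshSteps k w ⊆ F ∪ {firstVisit w k - 1, firstVisit w (2 * k + 1) - 1} := by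
      intro τ hτ
      by_cases hτF : τ ∈ F
      · exact Finset.mem_union_left _ hτF
      · refine Finset.mem_union_right _ ?_
        have hfr := (mem_freshSteps.1 hτ).2.firstVisit_eq
        have : w (τ + 1) = w k ∨ w (τ + 1) = w (2 * k + 1) := by
          by_contra hcon
          rw [not_or] at hcon
          exact hτF (Finset.mem_filter.2 ⟨hτ, hcon⟩)
        rcases this with h | h
        · rw [firstVisit_eq_of_eq h] at hfr
          simp [hfr]
        · rw [firstVisit_eq_of_eq h] at hfr
          simp [hfr]
    refine (Finset.card_le_card this).trans ((Finset.card_union_le _ _).trans ?_)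
    exact Nat.add_le_add_left Finset.card_le_two _
  refine h1.trans (Nat.add_le_add_right ?_ 2)
  have hex : ∀ τ ∈ F, ∃ σ ∈ secondSteps k w \ extraSteps k w, w σ = w (τ + 1) := by
    intro τ hτ
    obtain ⟨hτ, hk, hM⟩ := Finset.mem_filter.1 hτ
    have hs := mem_steps.1 (mem_freshSteps.1 hτ).1
    have hs' : τ + 1 ∈ steps k := by
      refine mem_steps.2 ⟨fun h => hk (by rw [h]), ?_⟩
      refine lt_of_le_of_ne (by omega) fun h => hM (by rw [h])
    obtain ⟨ρ, hρ, hρ1, -⟩ := hw.exists_second hs'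
    obtain ⟨σ, hσ, hmax⟩ := Finset.exists_max_image
      ((secondSteps k w).filter fun σ => w σ = w (τ + 1)) id
      ⟨ρ, Finset.mem_filter.2 ⟨hρ, hρ1⟩⟩
    rw [Finset.mem_filter] at hσ
    refine ⟨σ, Finset.mem_sdiff.2 ⟨hσ.1, fun hex => ?_⟩, hσ.2⟩
    obtain ⟨-, ρ', hρ', hlt, heq⟩ := Finset.mem_filter.1 hex
    have := hmax ρ' (Finset.mem_filter.2 ⟨hρ', heq.trans hσ.2⟩)
    simp only [id] at this
    omega
  choose! f hf1 hf2 using hex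
  refine Finset.card_le_card_of_injOn f hf1 fun a ha b hb hab => ?_
  have ha' := (mem_freshSteps.1 (Finset.mem_filter.1 ha).1).2
  have hb' := (mem_freshSteps.1 (Finset.mem_filter.1 hb).1).2
  have := ha'.eq hb' (by rw [← hf2 a ha, ← hf2 b hb, hab])
  omega

/-- There are at most fresh plus new second steps, and at least fresh minus two of them are not
extra; the number of fresh steps cancels. -/
lemma Good.card_extraSteps_le (hw : Good k w) :
    (extraSteps k w).card ≤ (newSteps k w).card + 2 := by
  have h1 := hw.card_freshSteps_le
  have h2 := Good.card_secondSteps_le (k := k) (w := w)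
  have h3 := Finset.card_sdiff_add_card_eq_card (Finset.filter_subset
    (fun τ => ∃ σ ∈ secondSteps k w, τ < σ ∧ w σ = w τ) (secondSteps k w))
  change ((secondSteps k w) \ (extraSteps k w)).card + (extraSteps k w).card = _ at h3
  omega

/-- Among the second steps from a given label, at most one is not extra. -/
lemma card_second_le (s : Finset ℕ) (hs : s ⊆ secondSteps k w) (u : V) (hu : ∀ σ ∈ s, w σ = u) :
    s.card ≤ (s ∩ extraSteps k w).card + 1 := by
  rw [← Finset.card_inter_add_card_sdiff s (extraSteps k w)]
  refine Nat.add_le_add_left (Finset.card_le_one.2 fun a ha b hb => ?_) _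
  rw [Finset.mem_sdiff] at ha hb
  wlog hlt : a < b generalizing a b
  · rcases (not_lt.1 hlt).lt_or_eq with h' | h'
    · exact (this b hb a ha h').symm
    · exact h'.symm
  exact absurd (Finset.mem_filter.2 ⟨hs ha.1, b, hs hb.1, hlt,
    (hu b hb.1).trans (hu a ha.1).symm⟩) ha.2

/-- An edge traversed once still awaits its second traversal, and different edges await different
steps. -/
lemma Good.openEdges_le [Fintype V] (hw : Good k w) (hτ : τ ≤ 2 * k + 1) :
    openEdges k w τ ≤ ((secondSteps k w).filter fun σ => τ ≤ σ ∧ w σ = w τ).card := by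
  have hex : ∀ v ∈ Finset.univ.filter fun v => traversals k w τ (w τ) v = 1,
      ∃ σ ∈ (secondSteps k w).filter fun σ => τ ≤ σ ∧ w σ = w τ, w (σ + 1) = v := by
    intro v hv
    have hv' := (Finset.mem_filter.1 hv).2
    obtain ⟨ρ, h1, h2, h3, h4, h5⟩ := exists_step (k := k) (w := w) (j := 0) (M := τ) (u := w τ)
      (v := v) (by omega)
    obtain ⟨σ, hσ, h6, h7⟩ := hw.exists_second (τ := ρ) (mem_steps.2 ⟨h2, by omega⟩)
    refine ⟨σ, Finset.mem_filter.2 ⟨hσ, ?_, h6.trans h3⟩, h7.trans h4⟩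
    by_contra hlt
    have h8 := count_lt_traversals (k := k) (w := w)
      (mem_steps.1 (mem_secondSteps.1 hσ).1).1 (not_le.1 hlt)
    rw [h6, h7, h3, h4, hv', (mem_secondSteps.1 hσ).2] at h8
    exact lt_irrefl _ h8
  choose! f hf1 hf2 using hex
  refine Finset.card_le_card_of_injOn f hf1 fun a ha b hb hab => ?_
  rw [← hf2 a ha, ← hf2 b hb, hab]

/-- At a second step that is not extra at most one edge is open, so only extra steps contribute,
each at most one plus the number of extra steps from then on. -/
lemma Good.prod_openEdges_le [Fintype V] (hw : Good k w) :
    ∏ τ ∈ secondSteps k w, openEdges k w τ ≤ ((newSteps k w).card + 3).factorial := by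
  calc ∏ τ ∈ secondSteps k w, openEdges k w τ
      ≤ ∏ τ ∈ secondSteps k w, (if τ ∈ extraSteps k w then
          1 + ((extraSteps k w).filter fun σ => τ ≤ σ).card else 1) := by
        refine Finset.prod_le_prod' fun τ hτ => ?_
        have hτ' := mem_steps.1 (mem_secondSteps.1 hτ).1
        refine (hw.openEdges_le (by omega)).trans ?_
        split_ifs with hex
        · refine (card_second_le _ (Finset.filter_subset _ _) (w τ) fun σ hσ =>
            (Finset.mem_filter.1 hσ).2.2).trans ?_
          rw [add_comm]
          refine Nat.add_le_add_left (Finset.card_le_card fun σ hσ => ?_) 1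
          rw [Finset.mem_inter, Finset.mem_filter] at hσ
          exact Finset.mem_filter.2 ⟨hσ.2, hσ.1.2.1⟩
        · refine Finset.card_le_one.2 fun a ha b hb => ?_
          rw [Finset.mem_filter] at ha hb
          have key : ∀ a ∈ secondSteps k w, τ ≤ a → w a = w τ → a = τ := fun a h1 h2 h3 => by
            by_contra hne
            exact hex (Finset.mem_filter.2 ⟨hτ, a, h1, lt_of_le_of_ne h2 (Ne.symm hne), h3⟩)
          rw [key a ha.1 ha.2.1 ha.2.2, key b hb.1 hb.2.1 hb.2.2]
    _ = ((extraSteps k w).card + 1).factorial := by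
        rw [Finset.prod_ite, Finset.prod_const_one, mul_one, Finset.filter_mem_eq_inter,
          Finset.inter_eq_right.2 (show extraSteps k w ⊆ secondSteps k w from
            Finset.filter_subset _ _), prod_one_add_card_ge]
    _ ≤ _ := Nat.factorial_le (Nat.succ_le_succ hw.card_extraSteps_le)

/-- All but one of the second steps from a label are extra, and first traversals from it are no more
numerous than second ones. The other departures are third steps. -/
lemma Good.departures_le (hw : Good k w) (hτ : τ ≤ 2 * k + 1) :
    departures k w τ ≤ 2 * ((newSteps k w).card + 3) +
      ((thirdSteps k w).filter fun σ => σ < τ).card := by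
  set R := (secondSteps k w).filter fun σ => w σ = w τ with hR
  set Z := (steps k).filter fun σ => count k w σ = 0 ∧ w σ = w τ with hZ
  have h1 : R.card ≤ (newSteps k w).card + 3 := by
    refine (card_second_le R (Finset.filter_subset _ _) (w τ) fun σ hσ =>
      (Finset.mem_filter.1 hσ).2).trans ?_
    have := Finset.card_le_card (Finset.inter_subset_right (s₁ := R) (s₂ := extraSteps k w))
    have := hw.card_extraSteps_le
    omega
  have h2 : Z.card ≤ R.card := by
    have hex : ∀ σ ∈ Z, ∃ ρ ∈ R, w ρ = w σ ∧ w (ρ + 1) = w (σ + 1) := fun σ hσ => by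
      rw [Finset.mem_filter] at hσ
      obtain ⟨ρ, h3, h4⟩ := hw.exists_second hσ.1
      exact ⟨ρ, Finset.mem_filter.2 ⟨h3, h4.1.trans hσ.2.2⟩, h4⟩
    choose! f hf1 hf2 hf3 using hex
    refine Finset.card_le_card_of_injOn f hf1 fun a ha b hb hab => ?_
    have ha' := Finset.mem_filter.1 ha
    have hb' := Finset.mem_filter.1 hb
    refine eq_of_count_eq (k := k) (w := w) (mem_steps.1 ha'.1).1 (mem_steps.1 hb'.1).1
      ?_ ?_ (ha'.2.1.trans hb'.2.1.symm)
    · rw [← hf2 a ha, ← hf2 b hb, hab]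
    · rw [← hf3 a ha, ← hf3 b hb, hab]
  have h3 : ((Finset.range τ).filter fun σ => σ ≠ k ∧ w σ = w τ) ⊆
      Z ∪ R ∪ (thirdSteps k w).filter fun σ => σ < τ := by
    intro σ hσ
    rw [Finset.mem_filter, Finset.mem_range] at hσ
    have hs : σ ∈ steps k := mem_steps.2 ⟨hσ.2.1, by omega⟩
    have : count k w σ = 0 ∨ count k w σ = 1 ∨ 2 ≤ count k w σ := by omega
    simp only [Finset.mem_union, hZ, hR, Finset.mem_filter, mem_secondSteps, mem_thirdSteps]
    tauto
  have h4 := Finset.card_le_card h3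
  have h5 := Finset.card_union_le (Z ∪ R) ((thirdSteps k w).filter fun σ => σ < τ)
  have h6 := Finset.card_union_le Z R
  unfold departures
  omega

lemma Good.prod_departures_le (hw : Good k w) :
    ∏ τ ∈ thirdSteps k w, departures k w τ ≤
      2 ^ (2 * ((newSteps k w).card + 3) + (thirdSteps k w).card) *
        (thirdSteps k w).card.factorial := by
  set c := 2 * ((newSteps k w).card + 3)
  calc ∏ τ ∈ thirdSteps k w, departures k w τ
      ≤ ∏ τ ∈ thirdSteps k w, (c + ((thirdSteps k w).filter fun σ => σ < τ).card) := by
        refine Finset.prod_le_prod' fun τ hτ => ?_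
        have hτ' := mem_steps.1 (mem_thirdSteps.1 hτ).1
        exact hw.departures_le (by omega)
    _ = c.ascFactorial (thirdSteps k w).card := prod_add_card_lt _ _
    -- The shift to `c + 1` gives the form `T! * (c + T).choose T`.
    _ ≤ (c + 1).ascFactorial (thirdSteps k w).card := by
        rw [Nat.ascFactorial_eq_prod_range, Nat.ascFactorial_eq_prod_range]
        exact Finset.prod_le_prod' fun i _ => by omega
    _ ≤ _ := by
        rw [Nat.ascFactorial_eq_factorial_mul_choose, mul_comm]
        exact Nat.mul_le_mul_right _ (Nat.choose_le_two_pow _ _)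

end Counting

end WalkPair

/-! ### Sequential summation over walks with transition kernels -/

namespace WalkPair

section Sequential

variable {V : Type*}

/-- The sequence that follows `p` and is constant after its last entry. -/
def extend {m : ℕ} (p : Fin (m + 1) → V) (i : ℕ) : V := p ⟨min i m, by omega⟩

lemma extend_snoc_of_le {m i : ℕ} (p : Fin (m + 1) → V) (v : V) (h : i ≤ m) :
    extend (Fin.snoc (α := fun _ => V) p v) i = extend p i := by
  unfold extend Fin.snoc
  have h1 : min i (m + 1) < m + 1 := by omega
  simp only [h1, dif_pos]
  simp only [Fin.castLT, cast_eq]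
  congr 2
  omega

lemma extend_snoc_last {m : ℕ} (p : Fin (m + 1) → V) (v : V) :
    extend (Fin.snoc (α := fun _ => V) p v) (m + 1) = v := by
  unfold extend Fin.snoc
  simp

lemma sum_extend_succ {M : Type*} [AddCommMonoid M] [Fintype V] {m : ℕ} (f : (ℕ → V) → M) :
    ∑ p : Fin (m + 2) → V, f (extend p) =
      ∑ p : Fin (m + 1) → V, ∑ v, f (extend (Fin.snoc (α := fun _ => V) p v)) := by
  rw [← Fintype.sum_prod_type', ← (Fin.snocEquiv fun _ : Fin (m + 2) => V).sum_comp,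
    ← (Equiv.prodComm _ _).sum_comp]
  rfl

/-- A sum over sequences of a product of kernels that depend only on the past is bounded by
telescoping. -/
lemma sum_prod_kernel_le [Fintype V] (M : ℕ) (κ B : ℕ → (ℕ → V) → ℝ)
    (hκ : ∀ τ < M, ∀ w, 0 ≤ κ τ w)
    (hκc : ∀ τ < M, ∀ w w' : ℕ → V, (∀ σ ≤ τ + 1, w σ = w' σ) → κ τ w = κ τ w')
    (hstep : ∀ m < M, ∀ (w : ℕ → V) (W : V → ℕ → V), (∀ v, ∀ σ ≤ m, W v σ = w σ) →
      (∀ v, W v (m + 1) = v) → ∑ v, κ m (W v) * B (m + 1) (W v) ≤ B m w) :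
    ∑ p : Fin (M + 1) → V, (∏ τ ∈ Finset.range M, κ τ (extend p)) * B M (extend p) ≤
      ∑ p : Fin 1 → V, B 0 (extend p) := by
  suffices h : ∀ m ≤ M,
      ∑ p : Fin (m + 1) → V, (∏ τ ∈ Finset.range m, κ τ (extend p)) * B m (extend p) ≤
        ∑ p : Fin 1 → V, B 0 (extend p) from h M le_rfl
  intro m
  induction m with
  | zero => simp
  | succ m ih =>
    intro hm
    refine le_trans ?_ (ih (by omega))
    rw [sum_extend_succ (m := m)
      (f := fun w => (∏ τ ∈ Finset.range (m + 1), κ τ w) * B (m + 1) w)]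
    refine Finset.sum_le_sum fun p _ => ?_
    have h1 : ∀ v : V, ∏ τ ∈ Finset.range (m + 1), κ τ (extend (Fin.snoc (α := fun _ => V) p v)) =
        (∏ τ ∈ Finset.range m, κ τ (extend p)) *
          κ m (extend (Fin.snoc (α := fun _ => V) p v)) := fun v => by
      rw [Finset.prod_range_succ]
      congr 1
      refine Finset.prod_congr rfl fun τ hτ => hκc τ ?_ _ _ fun σ hσ => ?_
      · have := Finset.mem_range.1 hτ; omega
      · exact extend_snoc_of_le p v (by have := Finset.mem_range.1 hτ; omega)
    simp_rw [h1, mul_assoc, ← Finset.mul_sum]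
    refine mul_le_mul_of_nonneg_left ?_
      (Finset.prod_nonneg fun τ hτ => hκ τ (by have := Finset.mem_range.1 hτ; omega) _)
    exact hstep m (by omega) _ _ (fun v σ hσ => extend_snoc_of_le p v hσ)
      (fun v => extend_snoc_last p v)

end Sequential

section Congr

variable {V : Type*} [DecidableEq V] {k τ : ℕ} {w w' : ℕ → V}

lemma traversals_congr (h : ∀ σ ≤ τ, w σ = w' σ) (u v : V) :
    traversals k w τ u v = traversals k w' τ u v := by
  unfold traversals
  congr 1
  refine Finset.filter_congr fun σ hσ => ?_
  have := Finset.mem_range.1 hσ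
  rw [h σ (by omega), h (σ + 1) (by omega)]

lemma fresh_congr (h : ∀ σ ≤ τ, w σ = w' σ) : Fresh w τ ↔ Fresh w' τ := by
  unfold Fresh
  refine forall₂_congr fun σ hσ => ?_
  rw [h σ hσ.le, h τ le_rfl]

lemma firstVisit_congr (h : ∀ σ ≤ τ, w σ = w' σ) : firstVisit w τ = firstVisit w' τ := by
  have h1 := firstVisit_le_self w τ
  have h2 := firstVisit_le_self w' τ
  refine le_antisymm (firstVisit_le ?_) (firstVisit_le ?_)
  · rw [h _ h2, h _ le_rfl, firstVisit_spec w' τ]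
  · rw [← h _ h1, ← h _ le_rfl, firstVisit_spec w τ]

lemma visits_congr (h : ∀ σ ≤ τ, w σ = w' σ) : visits w τ = visits w' τ := by
  unfold visits
  congr 1
  refine Finset.filter_congr fun σ hσ => ?_
  rw [h σ (Finset.mem_range.1 hσ).le, h τ le_rfl]

lemma departures_congr (h : ∀ σ ≤ τ, w σ = w' σ) : departures k w τ = departures k w' τ := by
  unfold departures
  congr 1
  refine Finset.filter_congr fun σ hσ => ?_
  rw [h σ (Finset.mem_range.1 hσ).le, h τ le_rfl]

lemma openEdges_congr [Fintype V] (h : ∀ σ ≤ τ, w σ = w' σ) :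
    openEdges k w τ = openEdges k w' τ := by
  unfold openEdges
  simp_rw [traversals_congr h, h τ le_rfl]

lemma decision_congr {Y : Finset ℕ} (h : ∀ σ ≤ τ, w σ = w' σ) :
    Decision k Y w τ ↔ Decision k Y w' τ := by
  unfold Decision
  rw [firstVisit_congr h, visits_congr h]

lemma count_congr (h : ∀ σ ≤ τ + 1, w σ = w' σ) : count k w τ = count k w' τ := by
  unfold count
  rw [traversals_congr fun σ hσ => h σ (by omega), h τ (by omega), h (τ + 1) le_rfl]

end Congr

section Kernel

variable {V : Type*} [DecidableEq V] [Fintype V]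

/-- The weight of a step to a fresh label. -/
def freshKernel (S : Matrix V V ℝ) (w : ℕ → V) (τ : ℕ) : ℝ :=
  if Fresh w (τ + 1) then S (w τ) (w (τ + 1)) else 0

/-- The uniform distribution on the edges that have been traversed once. -/
noncomputable def secondKernel (k : ℕ) (w : ℕ → V) (τ : ℕ) : ℝ :=
  if count k w τ = 1 then (openEdges k w τ : ℝ)⁻¹ else 0

/-- The empirical distribution of the earlier departures. -/
noncomputable def thirdKernel (k : ℕ) (w : ℕ → V) (τ : ℕ) : ℝ :=
  (count k w τ : ℝ) / departures k w τ

/-- The transition weights of pairs of walks with new steps at the times in `N`, marked first visits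
`Y` and branching first visits `X`. -/
noncomputable def kernel (S : Matrix V V ℝ) (L : ℝ) (k : ℕ) (N Y X : Finset ℕ) (τ : ℕ)
    (w : ℕ → V) : ℝ :=
  if τ = k then (if w (k + 1) = w 0 then 1 else 0)
  else if τ ∈ N then
    -- Uniform choice among the marked labels; `max 1` keeps the normalisation away from zero.
    (if ¬ Fresh w (τ + 1) ∧ firstVisit w (τ + 1) ∈ Y then ((max 1 Y.card : ℕ) : ℝ)⁻¹ else 0)
  else if Fresh w τ then freshKernel S w τ
  else if Decision k Y w τ then
    -- An equal mixture of the three possible types. The factor `L⁻¹` prepays for the run of fresh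
    -- steps that starts here, whose total weight is at most `L`.
    3⁻¹ * (L⁻¹ * freshKernel S w τ + secondKernel k w τ + thirdKernel k w τ)
  else if firstVisit w τ ∈ X then L⁻¹ * freshKernel S w τ else secondKernel k w τ

/-- A run of fresh steps that is under way at time `τ` ends at such a time. -/
def Halt (k : ℕ) (N : Finset ℕ) (τ : ℕ) : Prop := τ ∈ N ∨ τ = k ∨ 2 * k + 1 ≤ τ

instance (k : ℕ) (N : Finset ℕ) : DecidablePred (Halt k N) := fun τ => by
  unfold Halt; infer_instance

lemma exists_halt (k : ℕ) (N : Finset ℕ) (τ : ℕ) : ∃ j, Halt k N (τ + j) :=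
  ⟨2 * k + 1, Or.inr (Or.inr (by omega))⟩

/-- The number of steps left in a run of fresh steps. -/
def runLength (k : ℕ) (N : Finset ℕ) (τ : ℕ) : ℕ := Nat.find (exists_halt k N τ)

lemma runLength_of_halt {k : ℕ} {N : Finset ℕ} {τ : ℕ} (h : Halt k N τ) : runLength k N τ = 0 :=
  (Nat.find_eq_zero _).2 h

lemma runLength_of_not_halt {k : ℕ} {N : Finset ℕ} {τ : ℕ} (h : ¬ Halt k N τ) :
    runLength k N τ = runLength k N (τ + 1) + 1 := by
  unfold runLength
  rw [Nat.find_comp_succ (exists_halt k N τ)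
    (by obtain ⟨j, hj⟩ := exists_halt k N (τ + 1); exact ⟨j, by convert hj using 1; omega⟩) h]
  congr 1
  congr 1
  ext j
  rw [show τ + (j + 1) = τ + 1 + j by omega]

/-- The bound for the total weight of the continuations after time `τ`. -/
def potential (S : Matrix V V ℝ) (k : ℕ) (N : Finset ℕ) (τ : ℕ) (w : ℕ → V) : ℝ :=
  -- From a fresh label the kernel allows only fresh steps until the next halt, which gives a power
  -- of `S`. From an old label any later run is prepaid by its own `L⁻¹`.
  if Fresh w τ then ∑ v, (S ^ runLength k N τ) (w τ) v else 1

variable {S : Matrix V V ℝ} {L : ℝ} {k : ℕ} {N Y X : Finset ℕ} {τ : ℕ}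

lemma freshKernel_nonneg (hS : ∀ u v, 0 ≤ S u v) (w : ℕ → V) : 0 ≤ freshKernel S w τ := by
  unfold freshKernel; split_ifs <;> simp [hS]

lemma secondKernel_nonneg (w : ℕ → V) : 0 ≤ secondKernel k w τ := by
  unfold secondKernel; split_ifs <;> positivity

lemma thirdKernel_nonneg (w : ℕ → V) : 0 ≤ thirdKernel k w τ := by
  unfold thirdKernel; positivity

lemma kernel_nonneg (hS : ∀ u v, 0 ≤ S u v) (hL : 0 ≤ L) (w : ℕ → V) :
    0 ≤ kernel S L k N Y X τ w := by
  have h1 := freshKernel_nonneg (τ := τ) hS w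
  have h2 := secondKernel_nonneg (τ := τ) (k := k) w
  have h3 := thirdKernel_nonneg (τ := τ) (k := k) w
  unfold kernel
  split_ifs <;> positivity

lemma kernel_congr {w w' : ℕ → V} (h : ∀ σ ≤ τ + 1, w σ = w' σ) :
    kernel S L k N Y X τ w = kernel S L k N Y X τ w' := by
  have h' : ∀ σ ≤ τ, w σ = w' σ := fun σ hσ => h σ (by omega)
  have h1 : freshKernel S w τ = freshKernel S w' τ := by
    unfold freshKernel
    simp only [fresh_congr h, h τ (by omega), h (τ + 1) le_rfl]
  have h2 : secondKernel k w τ = secondKernel k w' τ := by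
    unfold secondKernel
    rw [count_congr h, openEdges_congr h']
  have h3 : thirdKernel k w τ = thirdKernel k w' τ := by
    unfold thirdKernel
    rw [count_congr h, departures_congr h']
  unfold kernel
  by_cases hk : τ = k
  · subst hk
    simp only [if_true, h 0 (by omega), h (τ + 1) le_rfl]
  · simp only [if_neg hk, fresh_congr h, fresh_congr h', firstVisit_congr h, firstVisit_congr h',
      decision_congr h', h1, h2, h3]

variable {w : ℕ → V} {W : V → ℕ → V}

lemma potential_of_count_pos (h : 0 < count k w τ) : potential S k N (τ + 1) w = 1 :=
  if_neg fun hf => by rw [hf.count_eq_zero] at h; exact lt_irrefl _ h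

lemma sum_secondKernel_le (hW : ∀ v, ∀ σ ≤ τ, W v σ = w σ) (hv : ∀ v, W v (τ + 1) = v) :
    ∑ v, secondKernel k (W v) τ * potential S k N (τ + 1) (W v) ≤ 1 := by
  have h1 : ∀ v, secondKernel k (W v) τ * potential S k N (τ + 1) (W v) =
      if traversals k w τ (w τ) v = 1 then (openEdges k w τ : ℝ)⁻¹ else 0 := fun v => by
    have hc : count k (W v) τ = traversals k w τ (w τ) v := by
      unfold count
      rw [traversals_congr (hW v), hW v τ le_rfl, hv]
    unfold secondKernel
    rw [openEdges_congr (hW v), hc]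
    split_ifs with h
    · rw [potential_of_count_pos (by omega), mul_one]
    · rw [zero_mul]
  simp_rw [h1]
  rw [← Finset.sum_filter, Finset.sum_const, nsmul_eq_mul]
  exact mul_inv_le_one

lemma sum_traversals (k : ℕ) (w : ℕ → V) (τ : ℕ) :
    ∑ v, traversals k w τ (w τ) v = departures k w τ := by
  unfold departures traversals
  rw [Finset.card_eq_sum_card_fiberwise (f := fun σ => w (σ + 1)) (t := Finset.univ)
    (fun _ _ => Finset.mem_coe.2 (Finset.mem_univ _))]
  refine Finset.sum_congr rfl fun v _ => ?_
  rw [Finset.filter_filter]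
  simp only [and_assoc]

lemma sum_thirdKernel_le (hW : ∀ v, ∀ σ ≤ τ, W v σ = w σ) (hv : ∀ v, W v (τ + 1) = v) :
    ∑ v, thirdKernel k (W v) τ * potential S k N (τ + 1) (W v) ≤ 1 := by
  have h1 : ∀ v, thirdKernel k (W v) τ * potential S k N (τ + 1) (W v) =
      (traversals k w τ (w τ) v : ℝ) / departures k w τ := fun v => by
    have hc : count k (W v) τ = traversals k w τ (w τ) v := by
      unfold count
      rw [traversals_congr (hW v), hW v τ le_rfl, hv]
    unfold thirdKernel
    rw [departures_congr (hW v), hc]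
    rcases Nat.eq_zero_or_pos (traversals k w τ (w τ) v) with h | h
    · simp [h]
    · rw [potential_of_count_pos (by omega), mul_one]
  simp_rw [h1]
  rw [← Finset.sum_div, ← Nat.cast_sum, sum_traversals]
  exact div_self_le_one _

lemma pow_apply_nonneg' (hS : ∀ u v, 0 ≤ S u v) (l : ℕ) (u v : V) : 0 ≤ (S ^ l) u v :=
  Matrix.pow_apply_nonneg hS l u v

lemma rowSum_succ (S : Matrix V V ℝ) (l : ℕ) (u : V) :
    ∑ v, S u v * ∑ x, (S ^ l) v x = ∑ x, (S ^ (l + 1)) u x := by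
  simp_rw [pow_succ', Matrix.mul_apply, Finset.mul_sum]
  exact Finset.sum_comm

/-- Dropping the requirement that the endpoint be fresh only adds nonnegative terms; what remains is
one more factor `S`. -/
lemma sum_freshKernel_le (hS : ∀ u v, 0 ≤ S u v) (hW : ∀ v, ∀ σ ≤ τ, W v σ = w σ)
    (hv : ∀ v, W v (τ + 1) = v) :
    ∑ v, freshKernel S (W v) τ * potential S k N (τ + 1) (W v) ≤
      ∑ x, (S ^ (runLength k N (τ + 1) + 1)) (w τ) x := by
  rw [← rowSum_succ]
  refine Finset.sum_le_sum fun v _ => ?_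
  unfold freshKernel potential
  rw [hW v τ le_rfl, hv]
  split_ifs with h
  · exact le_rfl
  · rw [zero_mul]
    exact mul_nonneg (hS _ _) (Finset.sum_nonneg fun x _ => pow_apply_nonneg' hS _ _ _)

lemma potential_of_halt (h : Halt k N τ) : potential S k N τ w = 1 := by
  unfold potential
  rw [runLength_of_halt h]
  simp [Matrix.one_apply]

/-- This is the supermartingale property. Within a run the powers of `S` compose at no cost; `hSL`
is needed only where a run starts from an old label, and there the kernel carries `L⁻¹`. -/
lemma sum_kernel_le (hS : ∀ u v, 0 ≤ S u v) (hL : 0 < L)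
    (hSL : ∀ l u, ∑ v, (S ^ l) u v ≤ L) (hτ : τ < 2 * k + 1)
    (hW : ∀ v, ∀ σ ≤ τ, W v σ = w σ) (hv : ∀ v, W v (τ + 1) = v) :
    ∑ v, kernel S L k N Y X τ (W v) * potential S k N (τ + 1) (W v) ≤ potential S k N τ w := by
  have hF := sum_freshKernel_le (k := k) (N := N) hS hW hv
  have hFL : ∑ v, L⁻¹ * freshKernel S (W v) τ * potential S k N (τ + 1) (W v) ≤ 1 := by
    simp_rw [mul_assoc, ← Finset.mul_sum]
    rw [inv_mul_le_iff₀ hL, mul_one]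
    exact hF.trans (hSL _ _)
  have hR := sum_secondKernel_le (S := S) (k := k) (N := N) hW hv
  have hT := sum_thirdKernel_le (S := S) (k := k) (N := N) hW hv
  unfold kernel
  by_cases hk : τ = k
  · subst hk
    rw [potential_of_halt (Or.inr (Or.inl rfl))]
    simp only [if_true, hv, hW _ 0 (Nat.zero_le τ), ite_mul, one_mul, zero_mul,
      Finset.sum_ite_eq', Finset.mem_univ]
    unfold potential
    rw [if_neg]
    intro h
    exact h 0 (Nat.succ_pos _) (by rw [hv, hW _ 0 (Nat.zero_le τ)])
  simp only [if_neg hk]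
  by_cases hN : τ ∈ N
  · rw [potential_of_halt (Or.inl hN)]
    simp only [if_pos hN]
    set m := max 1 Y.card
    have h1 : ∀ v, (if ¬ Fresh (W v) (τ + 1) ∧ firstVisit (W v) (τ + 1) ∈ Y then (m : ℝ)⁻¹ else 0) *
        potential S k N (τ + 1) (W v) =
        if ¬ Fresh (W v) (τ + 1) ∧ firstVisit (W v) (τ + 1) ∈ Y then (m : ℝ)⁻¹ else 0 := by
      intro v
      split_ifs with h
      · unfold potential
        rw [if_neg h.1, mul_one]
      · rw [zero_mul]
    simp_rw [h1]
    rw [← Finset.sum_filter, Finset.sum_const, nsmul_eq_mul]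
    have h2 : (Finset.univ.filter fun v =>
        ¬ Fresh (W v) (τ + 1) ∧ firstVisit (W v) (τ + 1) ∈ Y).card ≤ Y.card := by
      -- Distinct old labels have distinct first visits, so there are at most `Y.card` admissible
      -- targets.
      refine Finset.card_le_card_of_injOn (fun v => firstVisit (W v) (τ + 1))
        (fun v hv' => (Finset.mem_filter.1 hv').2.2) fun a ha b hb hab => ?_
      have ha' := firstVisit_lt (Finset.mem_filter.1 ha).2.1
      have hb' := firstVisit_lt (Finset.mem_filter.1 hb).2.1
      have h3 := firstVisit_spec (W a) (τ + 1)
      have h4 := firstVisit_spec (W b) (τ + 1)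
      rw [hv, hW _ _ (by omega)] at h3 h4
      simp only at hab
      rw [← h3, ← h4, hab]
    have hm : (0 : ℝ) < m := by
      have : 0 < m := lt_of_lt_of_le one_pos (le_max_left _ _)
      exact_mod_cast this
    rw [mul_inv_le_iff₀ hm, one_mul]
    exact_mod_cast h2.trans (le_max_right _ _)
  simp only [if_neg hN, fresh_congr (hW _), decision_congr (hW _), firstVisit_congr (hW _)]
  have hhalt : ¬ Halt k N τ := by
    unfold Halt
    rintro (h | h | h)
    · exact hN h
    · exact hk h
    · omega
  by_cases hf : Fresh w τ
  · simp only [if_pos hf]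
    refine hF.trans_eq ?_
    unfold potential
    rw [if_pos hf, runLength_of_not_halt hhalt]
  have hpot : potential S k N τ w = 1 := if_neg hf
  rw [hpot]
  simp only [if_neg hf]
  by_cases hd : Decision k Y w τ
  · simp only [if_pos hd, mul_assoc, ← Finset.mul_sum, add_mul, Finset.sum_add_distrib]
    simp only [mul_assoc, ← Finset.mul_sum] at hFL
    linarith
  simp only [if_neg hd]
  split_ifs
  · exact hFL
  · exact hR

/-- The total weight of all pairs of walks with given times of the new steps. -/
lemma sum_prod_kernel_le_card_mul (hS : ∀ u v, 0 ≤ S u v) (hL : 0 < L)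
    (hSL : ∀ l u, ∑ v, (S ^ l) u v ≤ L) :
    ∑ p : Fin (2 * k + 1 + 1) → V, ∏ τ ∈ Finset.range (2 * k + 1), kernel S L k N Y X τ (extend p) ≤
      Fintype.card V * L := by
  have h := sum_prod_kernel_le (V := V) (2 * k + 1) (kernel S L k N Y X) (potential S k N)
    (fun τ _ w => kernel_nonneg hS hL.le w) (fun τ _ w w' h => kernel_congr h)
    (fun m hm w W hW hv => sum_kernel_le hS hL hSL hm hW hv)
  simp only [potential_of_halt (Or.inr (Or.inr le_rfl) : Halt k N (2 * k + 1)), mul_one] at h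
  refine h.trans ((Finset.sum_le_card_nsmul _ _ L fun p _ => ?_).trans_eq ?_)
  · unfold potential
    rw [if_pos (fresh_zero _)]
    exact hSL _ _
  · simp

end Kernel

end WalkPair

/-! ### Comparison of walk weights with the kernels -/

namespace WalkPair

section Weight

variable {V : Type*} [DecidableEq V]

/-- The weight of traversing the edge `(u, v)` after `r` earlier traversals. -/
def edgeWeight (b : Matrix V V ℝ) (Θ : ℝ) (u v : V) (r : ℕ) : ℝ :=
  if r = 0 then b u v ^ 2 else if r = 1 then 1 else b u v * Θ * r

/-- The weight of a pair of walks. -/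
def pairWeight (b : Matrix V V ℝ) (Θ : ℝ) (k : ℕ) (w : ℕ → V) : ℝ :=
  ∏ τ ∈ steps k, edgeWeight b Θ (w τ) (w (τ + 1)) (count k w τ)

lemma edgeWeight_nonneg {b : Matrix V V ℝ} {Θ : ℝ} (hb : ∀ u v, 0 ≤ b u v) (hΘ : 0 ≤ Θ) (u v : V)
    (r : ℕ) : 0 ≤ edgeWeight b Θ u v r := by
  have := hb u v
  unfold edgeWeight
  split_ifs <;> positivity

/-- A product over the steps can be arranged according to the edges. -/
lemma prod_steps_eq [Fintype V] (h : V → V → ℕ → ℝ) (k : ℕ) (w : ℕ → V) :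
    ∏ τ ∈ steps k, h (w τ) (w (τ + 1)) (count k w τ) =
      ∏ u, ∏ v, ∏ r ∈ Finset.range (traversals k w (2 * k + 1) u v), h u v r := by
  have key : ∀ M, ∏ τ ∈ (Finset.range M).erase k, h (w τ) (w (τ + 1)) (count k w τ) =
      ∏ u, ∏ v, ∏ r ∈ Finset.range (traversals k w M u v), h u v r := by
    intro M
    induction M with
    | zero => simp [traversals]
    | succ M ih =>
      by_cases hM : M = k
      · have h1 : (Finset.range (M + 1)).erase k = (Finset.range M).erase k := by
          rw [Finset.range_add_one, hM, Finset.erase_insert (by simp),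
            Finset.erase_eq_of_notMem (by simp)]
        rw [h1, ih]
        simp only [traversals_succ, hM, ne_eq, not_true, false_and, if_false, add_zero]
      · rw [Finset.range_add_one, Finset.erase_insert_of_ne hM,
          Finset.prod_insert (by simp), ih]
        have h2 : ∀ u v, ∏ r ∈ Finset.range (traversals k w (M + 1) u v), h u v r =
            (if u = w M then (if v = w (M + 1) then h u v (count k w M) else 1) else 1) *
              ∏ r ∈ Finset.range (traversals k w M u v), h u v r := by
          intro u v
          rw [traversals_succ]
          by_cases hu : u = w M
          · by_cases hv : v = w (M + 1)
            · subst hu hv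
              simp only [ne_eq, hM, not_false_eq_true, and_self, if_true]
              rw [Finset.prod_range_succ, mul_comm]
              rfl
            · rw [if_neg (by tauto), if_pos hu, if_neg hv, add_zero, one_mul]
          · rw [if_neg (by tauto), if_neg hu, add_zero, one_mul]
        simp_rw [h2, Finset.prod_mul_distrib]
        congr 1
        rw [Finset.prod_eq_single (w M) (fun u _ hu => by simp [hu]) (by simp),
          Finset.prod_eq_single (w (M + 1)) (fun v _ hv => by simp [hv]) (by simp)]
        simp
  exact key _

/-- The factors of a repeated edge multiply to the moment bound of `integral_norm_pow_le`. -/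
lemma prod_edgeWeight (b : Matrix V V ℝ) (Θ : ℝ) (u v : V) (m : ℕ) :
    ∏ r ∈ Finset.range (m + 2), edgeWeight b Θ u v r =
      b u v ^ (m + 2) * (Θ ^ m * (m + 1).factorial) := by
  induction m with
  | zero => simp [Finset.prod_range_succ, edgeWeight]
  | succ m ih =>
    rw [Finset.prod_range_succ, ih, Nat.factorial_succ (m + 1)]
    unfold edgeWeight
    rw [if_neg (by omega), if_neg (by omega)]
    push_cast
    ring

variable [Fintype V] {b : Matrix V V ℝ} {L Θ δ : ℝ} {k τ : ℕ} {w : ℕ → V}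

/-- The loss in the comparison of the weight of a step with the transition weight. -/
noncomputable def stepLoss (L Θ δ : ℝ) (k : ℕ) (w : ℕ → V) (τ : ℕ) : ℝ :=
  (if τ ∉ newSteps k w ∧ ¬ Fresh w τ ∧ Decision k (marked k w) w τ then 3 * L else 1) *
  (if τ ∈ freshSteps k w ∧ ¬ Fresh w τ ∧ ¬ Decision k (marked k w) w τ then L else 1) *
  (if τ ∈ newSteps k w then δ ^ 2 * (max 1 (marked k w).card : ℕ) else 1) *
  (if τ ∈ secondSteps k w then (openEdges k w τ : ℝ) else 1) *
  (if τ ∈ thirdSteps k w then δ * Θ * departures k w τ else 1)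

/-- The loss bounds the ratio of weight to kernel for each type of step. It equals one inside a run
of fresh steps, so long runs are free. -/
lemma edgeWeight_le_stepLoss_mul_kernel (hL : 1 ≤ L) (hΘ : 0 ≤ Θ) (hb : ∀ u v, 0 ≤ b u v)
    (hbδ : ∀ u v, b u v ≤ δ) (hτ : τ ∈ steps k) :
    edgeWeight b Θ (w τ) (w (τ + 1)) (count k w τ) ≤ stepLoss L Θ δ k w τ *
      kernel (Matrix.of fun u v => b u v ^ 2) L k (newSteps k w) (marked k w) (branching k w)
        τ w := by
  have hτ' := mem_steps.1 hτ
  have hL0 : 0 < L := by linarith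
  set S : Matrix V V ℝ := Matrix.of fun u v => b u v ^ 2 with hS
  have hSnn : ∀ u v, 0 ≤ S u v := fun u v => sq_nonneg _
  have hfk := freshKernel_nonneg (τ := τ) hSnn w
  have hsk := secondKernel_nonneg (τ := τ) (k := k) w
  have htk := thirdKernel_nonneg (τ := τ) (k := k) w
  have hbτ := hb (w τ) (w (τ + 1))
  have hbδτ := hbδ (w τ) (w (τ + 1))
  have hδ : 0 ≤ δ := hbτ.trans hbδτ
  unfold stepLoss kernel
  rw [if_neg hτ'.1]
  have hFS : τ ∈ freshSteps k w → count k w τ = 0 ∧ freshKernel S w τ = b (w τ) (w (τ + 1)) ^ 2 :=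
    fun h => ⟨(mem_freshSteps.1 h).2.count_eq_zero, if_pos (mem_freshSteps.1 h).2⟩
  have hRS : τ ∈ secondSteps k w → count k w τ = 1 ∧
      (openEdges k w τ : ℝ) * secondKernel k w τ = 1 := fun h => by
    have hc := (mem_secondSteps.1 h).2
    refine ⟨hc, ?_⟩
    unfold secondKernel
    rw [if_pos hc]
    refine mul_inv_cancel₀ ?_
    have : 0 < openEdges k w τ := Finset.card_pos.2 ⟨w (τ + 1), by simpa [count] using hc⟩
    exact_mod_cast this.ne'
  by_cases hN : τ ∈ newSteps k w
  · have hN' := mem_newSteps.1 hN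
    have h1 : τ ∉ freshSteps k w := fun h => hN'.2.1 (mem_freshSteps.1 h).2
    have h2 : τ ∉ secondSteps k w := fun h => by have := (mem_secondSteps.1 h).2; omega
    have h3 : τ ∉ thirdSteps k w := fun h => by have := (mem_thirdSteps.1 h).2; omega
    have h4 : firstVisit w (τ + 1) ∈ marked k w :=
      Finset.mem_image_of_mem (fun σ => firstVisit w (σ + 1)) hN
    rw [if_neg (by tauto), if_neg (by tauto), if_pos hN, if_neg h2, if_neg h3, if_pos hN,
      if_pos ⟨hN'.2.1, h4⟩]
    unfold edgeWeight
    rw [if_pos hN'.2.2]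
    have hm : (0 : ℝ) < (max 1 (marked k w).card : ℕ) := by
      have : 0 < max 1 (marked k w).card := lt_of_lt_of_le one_pos (le_max_left _ _)
      exact_mod_cast this
    rw [one_mul, one_mul, mul_one, mul_one, mul_assoc, mul_inv_cancel₀ hm.ne', mul_one]
    exact pow_le_pow_left₀ hbτ hbδτ 2
  rw [if_neg hN, if_neg hN]
  by_cases hf : Fresh w τ
  · have h := fresh_departure hτ hN hf
    have h1 := hFS h
    have h2 : τ ∉ secondSteps k w := fun h => by have := (mem_secondSteps.1 h).2; omega
    have h3 : τ ∉ thirdSteps k w := fun h => by have := (mem_thirdSteps.1 h).2; omega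
    rw [if_neg (by tauto), if_neg (by tauto), if_neg h2, if_neg h3, if_pos hf, h1.2]
    unfold edgeWeight
    rw [if_pos h1.1]
    simp
  rw [if_neg hf]
  by_cases hd : Decision k (marked k w) w τ
  · rw [if_pos ⟨hN, hf, hd⟩, if_neg (by tauto), if_pos hd, mul_one, mul_one]
    rcases step_cases (w := w) hτ with h | h | h | h
    · have h1 := hFS h
      have h2 : τ ∉ secondSteps k w := fun h => by have := (mem_secondSteps.1 h).2; omega
      have h3 : τ ∉ thirdSteps k w := fun h => by have := (mem_thirdSteps.1 h).2; omega
      rw [if_neg h2, if_neg h3, mul_one, mul_one]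
      unfold edgeWeight
      rw [if_pos h1.1, ← h1.2]
      calc freshKernel S w τ = 3 * L * (3⁻¹ * (L⁻¹ * freshKernel S w τ + 0 + 0)) := by
            field_simp
            ring
        _ ≤ _ := by gcongr
    · exact absurd h hN
    · have h1 := hRS h
      have h3 : τ ∉ thirdSteps k w := fun h => by have := (mem_thirdSteps.1 h).2; omega
      rw [if_pos h, if_neg h3, mul_one]
      unfold edgeWeight
      rw [if_neg (by omega), if_pos h1.1]
      calc (1 : ℝ) ≤ L * ((openEdges k w τ : ℝ) * secondKernel k w τ) := by rw [h1.2]; linarith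
        _ = 3 * L * (openEdges k w τ : ℝ) * (3⁻¹ * (0 + secondKernel k w τ + 0)) := by ring
        _ ≤ _ := by gcongr; positivity
    · have hc := (mem_thirdSteps.1 h).2
      have h2 : τ ∉ secondSteps k w := fun h => by have := (mem_secondSteps.1 h).2; omega
      rw [if_neg h2, if_pos h, mul_one]
      unfold edgeWeight
      rw [if_neg (by omega), if_neg (by omega)]
      have hdep : 0 < departures k w τ := by
        rw [← sum_traversals]
        refine lt_of_lt_of_le ?_ (Finset.single_le_sum (f := fun v => traversals k w τ (w τ) v)
          (fun _ _ => Nat.zero_le _) (Finset.mem_univ (w (τ + 1))))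
        exact lt_of_lt_of_le two_pos hc
      have hdep' : (0 : ℝ) < departures k w τ := by exact_mod_cast hdep
      have h4 : (departures k w τ : ℝ) * thirdKernel k w τ = count k w τ := by
        unfold thirdKernel
        field_simp
      calc b (w τ) (w (τ + 1)) * Θ * (count k w τ : ℝ) ≤ δ * Θ * count k w τ := by gcongr
        _ = 1 * (δ * Θ * count k w τ) := (one_mul _).symm
        _ ≤ L * (δ * Θ * count k w τ) := by gcongr
        _ = 3 * L * (δ * Θ * departures k w τ) * (3⁻¹ * (0 + 0 + thirdKernel k w τ)) := by
            rw [← h4]; ring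
        _ ≤ _ := by gcongr; positivity
  · rw [if_neg (by tauto), if_neg hd]
    rcases not_decision_cases hτ hN hf hd with ⟨h, hb'⟩ | ⟨h, hb'⟩
    · have h1 := hFS h
      have h2 : τ ∉ secondSteps k w := fun h => by have := (mem_secondSteps.1 h).2; omega
      have h3 : τ ∉ thirdSteps k w := fun h => by have := (mem_thirdSteps.1 h).2; omega
      rw [if_pos ⟨h, hf, hd⟩, if_neg h2, if_neg h3, if_pos hb', h1.2]
      unfold edgeWeight
      rw [if_pos h1.1]
      field_simp
      exact le_rfl
    · have h1 := hRS h
      have h2 : τ ∉ freshSteps k w := fun h => by have := (hFS h).1; omega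
      have h3 : τ ∉ thirdSteps k w := fun h => by have := (mem_thirdSteps.1 h).2; omega
      rw [if_neg (by tauto), if_pos h, if_neg h3, if_neg hb']
      unfold edgeWeight
      rw [if_neg (by omega), if_pos h1.1]
      simp only [one_mul, mul_one]
      exact h1.2.ge

lemma prod_ite_const_eq (s : Finset ℕ) (p : ℕ → Prop) [DecidablePred p] (c : ℝ) :
    ∏ τ ∈ s, (if p τ then c else 1) = c ^ (s.filter p).card := by
  rw [← Finset.prod_filter, Finset.prod_const]

/-- Nontrivial losses occur only at exceptional steps, so the bound sees the length `k` only through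
the numbers of new steps, marks and third steps. -/
lemma Good.prod_stepLoss_le (hw : Good k w) (hL : 1 ≤ L) (hΘ : 0 ≤ Θ) (hδ : 0 ≤ δ) :
    ∏ τ ∈ steps k, stepLoss L Θ δ k w τ ≤
      (3 * L) ^ (3 * (newSteps k w).card + (thirdSteps k w).card + 3) *
      L ^ (thirdSteps k w).card *
      (δ ^ 2 * (max 1 (marked k w).card : ℕ)) ^ (newSteps k w).card *
      ((newSteps k w).card + 3).factorial *
      ((δ * Θ) ^ (thirdSteps k w).card *
        (2 ^ (2 * ((newSteps k w).card + 3) + (thirdSteps k w).card) *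
          (thirdSteps k w).card.factorial)) := by
  have hsub : ∀ t : Finset ℕ, t ⊆ steps k → (steps k).filter (· ∈ t) = t := fun t ht => by
    rw [Finset.filter_mem_eq_inter, Finset.inter_eq_right.2 ht]
  have e3 : (steps k).filter (fun τ => τ ∈ newSteps k w) = newSteps k w :=
    hsub _ (Finset.filter_subset _ _)
  have e4 : (steps k).filter (fun τ => τ ∈ secondSteps k w) = secondSteps k w :=
    hsub _ (Finset.filter_subset _ _)
  have e5 : (steps k).filter (fun τ => τ ∈ thirdSteps k w) = thirdSteps k w :=
    hsub _ (Finset.filter_subset _ _)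
  unfold stepLoss
  simp only [Finset.prod_mul_distrib]
  rw [prod_ite_const_eq, prod_ite_const_eq, prod_ite_const_eq, e3, ← Finset.prod_filter, e4,
    ← Finset.prod_filter, e5, Finset.prod_mul_distrib, Finset.prod_mul_distrib,
    Finset.prod_const, Finset.prod_const, ← Nat.cast_prod, ← Nat.cast_prod, ← mul_pow]
  have h1 : ((steps k).filter fun τ => τ ∉ newSteps k w ∧ ¬ Fresh w τ ∧
      Decision k (marked k w) w τ).card ≤
      3 * (newSteps k w).card + (thirdSteps k w).card + 3 := by
    refine le_trans (Finset.card_le_card fun τ hτ => ?_) hw.card_decision_le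
    rw [Finset.mem_filter] at hτ ⊢
    exact ⟨Finset.mem_sdiff.2 ⟨hτ.1, hτ.2.1⟩, hτ.2.2⟩
  have h2 : ((steps k).filter fun τ => τ ∈ freshSteps k w ∧ ¬ Fresh w τ ∧
      ¬ Decision k (marked k w) w τ).card ≤ (thirdSteps k w).card := by
    refine le_trans ?_ hw.card_branching_le
    refine Finset.card_le_card_of_injOn (firstVisit w) (fun τ hτ => ?_) (fun a ha b hb hab => ?_)
    · exact Finset.mem_image_of_mem _ (Finset.mem_filter.2 (Finset.mem_filter.1 hτ).2)
    · have ha' := (Finset.mem_filter.1 ha).2.2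
      have hb' := (Finset.mem_filter.1 hb).2.2
      exact eq_of_not_decision ha'.2 hb'.2 ha'.1 hb'.1 hab
  have h3 : ((∏ τ ∈ secondSteps k w, openEdges k w τ : ℕ) : ℝ) ≤
      ((newSteps k w).card + 3).factorial := by exact_mod_cast hw.prod_openEdges_le
  have h4 : ((∏ τ ∈ thirdSteps k w, departures k w τ : ℕ) : ℝ) ≤
      2 ^ (2 * ((newSteps k w).card + 3) + (thirdSteps k w).card) *
        (thirdSteps k w).card.factorial := by exact_mod_cast hw.prod_departures_le
  have h5 : (3 * L) ^ ((steps k).filter fun τ => τ ∉ newSteps k w ∧ ¬ Fresh w τ ∧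
      Decision k (marked k w) w τ).card ≤
      (3 * L) ^ (3 * (newSteps k w).card + (thirdSteps k w).card + 3) :=
    pow_le_pow_right₀ (by linarith) h1
  have h6 : L ^ ((steps k).filter fun τ => τ ∈ freshSteps k w ∧ ¬ Fresh w τ ∧
      ¬ Decision k (marked k w) w τ).card ≤ L ^ (thirdSteps k w).card :=
    pow_le_pow_right₀ hL h2
  gcongr

lemma Good.pairWeight_le (hw : Good k w) (hL : 1 ≤ L) (hΘ : 0 ≤ Θ) (hb : ∀ u v, 0 ≤ b u v)
    (hbδ : ∀ u v, b u v ≤ δ) :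
    pairWeight b Θ k w ≤ (∏ τ ∈ steps k, stepLoss L Θ δ k w τ) *
      ∏ τ ∈ Finset.range (2 * k + 1), kernel (Matrix.of fun u v => b u v ^ 2) L k
        (newSteps k w) (marked k w) (branching k w) τ w := by
  -- The jump has kernel one, so time `k` can be added to the product.
  have h1 : kernel (Matrix.of fun u v => b u v ^ 2) L k
      (newSteps k w) (marked k w) (branching k w) k w = 1 := by
    unfold kernel
    rw [if_pos rfl, if_pos hw.jump]
  rw [← Finset.mul_prod_erase _ _ (Finset.mem_range.2 (by omega : k < 2 * k + 1)), h1, one_mul]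
  unfold pairWeight
  change _ ≤ _ * ∏ τ ∈ steps k, _
  rw [← Finset.prod_mul_distrib]
  exact Finset.prod_le_prod (fun τ _ => edgeWeight_nonneg hb hΘ _ _ _)
    fun τ hτ => edgeWeight_le_stepLoss_mul_kernel hL hΘ hb hbδ hτ

end Weight

end WalkPair

/-! ### Summation over codes -/

namespace WalkPair

section Total

lemma self_pow_le_exp_mul_factorial (y : ℕ) :
    (y : ℝ) ^ y ≤ Real.exp 1 ^ y * (y.factorial : ℝ) := by
  have h := Real.pow_div_factorial_le_exp (y : ℝ) (Nat.cast_nonneg y) y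
  have h0 : (0 : ℝ) < y.factorial := by exact_mod_cast y.factorial_pos
  rw [div_le_iff₀ h0] at h
  rwa [← Real.exp_nat_mul, mul_one]

lemma self_pow_le_three_pow_mul_factorial (y : ℕ) : y ^ y ≤ 3 ^ y * y.factorial := by
  have h : (y : ℝ) ^ y ≤ 3 ^ y * y.factorial :=
    (self_pow_le_exp_mul_factorial y).trans (by gcongr; exact Real.exp_one_lt_three.le)
  exact_mod_cast h

lemma choose_mul_factorial_le_pow (m y : ℕ) : m.choose y * y.factorial ≤ m ^ y := by
  rw [mul_comm, ← Nat.descFactorial_eq_factorial_mul_choose]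
  exact Nat.descFactorial_le_pow m y

/-- The binomial coefficient absorbs `y ^ y ≤ 3 ^ y * y!`, and the remaining `i - y` factors are at
most `m`. -/
lemma choose_mul_max_pow_le {m y i : ℕ} (hm : 1 ≤ m) (hy : y ≤ i) :
    m.choose y * (max 1 y) ^ i ≤ (3 * m) ^ i := by
  rcases Nat.eq_zero_or_pos y with rfl | hy0
  · simpa using Nat.one_le_pow _ _ (by omega)
  rcases lt_or_ge m y with h | h
  · simp [Nat.choose_eq_zero_of_lt h]
  rw [max_eq_right hy0]
  calc m.choose y * y ^ i = m.choose y * y ^ y * y ^ (i - y) := by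
        rw [mul_assoc, ← pow_add, Nat.add_sub_cancel' hy]
    _ ≤ m.choose y * (3 ^ y * y.factorial) * m ^ (i - y) := by
        gcongr
        exact self_pow_le_three_pow_mul_factorial y
    _ = (m.choose y * y.factorial) * 3 ^ y * m ^ (i - y) := by ring
    _ ≤ m ^ y * 3 ^ i * m ^ (i - y) := by
        gcongr
        · exact choose_mul_factorial_le_pow m y
        · norm_num
    _ = 3 ^ i * (m ^ y * m ^ (i - y)) := by ring
    _ = (3 * m) ^ i := by rw [← pow_add, Nat.add_sub_cancel' hy, mul_pow]

/-- The binomial coefficient absorbs `x!`, and the other `T - x` factors of `T!` are at most `m`. -/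
lemma choose_mul_factorial_le_pow_of_le {m x T : ℕ} (hx : x ≤ T) (hT : T ≤ m) :
    m.choose x * T.factorial ≤ m ^ T := by
  have h := Nat.factorial_mul_descFactorial (Nat.sub_le T x)
  rw [Nat.sub_sub_self hx] at h
  calc m.choose x * T.factorial = (m.choose x * x.factorial) * T.descFactorial (T - x) := by
        rw [← h, mul_assoc]
    _ ≤ m ^ x * m ^ (T - x) := by
        gcongr
        · exact choose_mul_factorial_le_pow m x
        · exact (Nat.descFactorial_le_pow _ _).trans (Nat.pow_le_pow_left hT _)
    _ = m ^ T := by rw [← pow_add, Nat.add_sub_cancel' hx]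

lemma factorial_add_three_le (i : ℕ) : (i + 3).factorial ≤ 6 * 4 ^ i * i.factorial := by
  induction i with
  | zero => decide
  | succ i ih =>
    rw [show i + 1 + 3 = (i + 3) + 1 by ring, Nat.factorial_succ (i + 3), Nat.factorial_succ i,
      pow_succ]
    calc (i + 3 + 1) * (i + 3).factorial ≤ (4 * (i + 1)) * (6 * 4 ^ i * i.factorial) :=
          Nat.mul_le_mul (by omega) ih
      _ = _ := by ring

lemma sum_max_pow_le {m : ℕ} (hm : 1 ≤ m) (i : ℕ) :
    ∑ Y ∈ (Finset.range m).powerset with Y.card ≤ i, (max 1 Y.card) ^ i ≤ (6 * m) ^ i := by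
  rw [Finset.sum_filter, Finset.sum_powerset_apply_card
    (fun y => if y ≤ i then (max 1 y) ^ i else 0), Finset.card_range]
  calc _ = ∑ y ∈ Finset.range (m + 1), if y ≤ i then m.choose y * (max 1 y) ^ i else 0 := by
        refine Finset.sum_congr rfl fun y _ => ?_
        split_ifs <;> simp
    _ = ∑ y ∈ Finset.range (m + 1) with y ≤ i, m.choose y * (max 1 y) ^ i := by
        rw [Finset.sum_filter]
    _ ≤ ∑ y ∈ Finset.range (i + 1), m.choose y * (max 1 y) ^ i := by
        refine Finset.sum_le_sum_of_subset fun y hy => ?_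
        have := (Finset.mem_filter.1 hy).2
        exact Finset.mem_range.2 (by omega)
    _ ≤ ∑ _y ∈ Finset.range (i + 1), (3 * m) ^ i := Finset.sum_le_sum fun y hy =>
        choose_mul_max_pow_le hm (by have := Finset.mem_range.1 hy; omega)
    _ = (i + 1) * (3 * m) ^ i := by simp
    _ ≤ 2 ^ i * (3 * m) ^ i := by gcongr; exact Nat.lt_two_pow_self
    _ = (6 * m) ^ i := by rw [← mul_pow]; ring

lemma card_powerset_mul_factorial_le {m T : ℕ} (hT : T ≤ m) :
    ((Finset.range m).powerset.filter fun X => X.card ≤ T).card * T.factorial ≤ (2 * m) ^ T := by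
  rw [Finset.card_filter, Finset.sum_powerset_apply_card
    (fun y => if y ≤ T then 1 else 0), Finset.card_range, Finset.sum_mul]
  calc _ = ∑ y ∈ Finset.range (m + 1), if y ≤ T then m.choose y * T.factorial else 0 := by
        refine Finset.sum_congr rfl fun y _ => ?_
        split_ifs <;> simp
    _ = ∑ y ∈ Finset.range (m + 1) with y ≤ T, m.choose y * T.factorial := by
        rw [Finset.sum_filter]
    _ ≤ ∑ y ∈ Finset.range (T + 1), m.choose y * T.factorial := by
        refine Finset.sum_le_sum_of_subset fun y hy => ?_
        have := (Finset.mem_filter.1 hy).2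
        exact Finset.mem_range.2 (by omega)
    _ ≤ ∑ _y ∈ Finset.range (T + 1), m ^ T := Finset.sum_le_sum fun y hy =>
        choose_mul_factorial_le_pow_of_le (by have := Finset.mem_range.1 hy; omega) hT
    _ = (T + 1) * m ^ T := by simp
    _ ≤ 2 ^ T * m ^ T := by gcongr; exact Nat.lt_two_pow_self
    _ = (2 * m) ^ T := by rw [← mul_pow]

lemma sum_geometric_le_two {q : ℝ} (h0 : 0 ≤ q) (h1 : q ≤ 1 / 2) (N : ℕ) :
    ∑ i ∈ Finset.range N, q ^ i ≤ 2 := by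
  calc ∑ i ∈ Finset.range N, q ^ i ≤ ∑ i ∈ Finset.range N, (1 / 2 : ℝ) ^ i :=
        Finset.sum_le_sum fun i _ => pow_le_pow_left₀ h0 h1 i
    _ ≤ 2 := sum_geometric_two_le N

/-- The weight of a code with `i` new steps, `y` marks and `T` repeated steps. -/
noncomputable def codeWeight (L Θ δ : ℝ) (i y T : ℕ) : ℝ :=
  (3 * L) ^ (3 * i + T + 3) * L ^ T * (δ ^ 2 * (max 1 y : ℕ)) ^ i * (i + 3).factorial *
    ((δ * Θ) ^ T * (2 ^ (2 * (i + 3) + T) * T.factorial))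

lemma codeWeight_nonneg {L Θ δ : ℝ} (hL : 0 ≤ L) (hΘ : 0 ≤ Θ) (hδ : 0 ≤ δ) (i y T : ℕ) :
    0 ≤ codeWeight L Θ δ i y T := by
  unfold codeWeight
  positivity

/-- The codes of pairs of walks with `m` labels. -/
def codes (m : ℕ) : Finset (Σ _ : ℕ, Σ _ : Finset ℕ, Finset ℕ × Finset ℕ) :=
  (Finset.range m).sigma fun T => (Finset.range m).powerset.sigma fun N =>
    ((Finset.range m).powerset.filter fun Y => Y.card ≤ N.card) ×ˢ
      ((Finset.range m).powerset.filter fun X => X.card ≤ T)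

lemma mem_codes {m : ℕ} {c : Σ _ : ℕ, Σ _ : Finset ℕ, Finset ℕ × Finset ℕ} :
    c ∈ codes m ↔ c.1 < m ∧ c.2.1 ⊆ Finset.range m ∧
      (c.2.2.1 ⊆ Finset.range m ∧ c.2.2.1.card ≤ c.2.1.card) ∧
      (c.2.2.2 ⊆ Finset.range m ∧ c.2.2.2.card ≤ c.1) := by
  simp only [codes, Finset.mem_sigma, Finset.mem_range, Finset.mem_powerset, Finset.mem_product,
    Finset.mem_filter]

/-- The entropy `m.choose i` of the times cancels the factorial from open edges, and the choice of
marks costs another `m ^ i`; so `i` new steps cost about `(m * δ) ^ (2 * i)`. Likewise `T` third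
steps cost about `(Θ * m * δ) ^ T`. Both series are geometric. -/
lemma sum_codes_le {L Θ δ : ℝ} {m : ℕ} (hL : 1 ≤ L) (hΘ : 0 ≤ Θ) (hδ : 0 ≤ δ) (hm : 1 ≤ m)
    (h1 : 2592 * L ^ 3 * (m * δ) ^ 2 ≤ 1 / 2) (h2 : 12 * L ^ 2 * Θ * (m * δ) ≤ 1 / 2) :
    ∑ c ∈ codes m, codeWeight L Θ δ c.2.1.card c.2.2.1.card c.1 ≤ 41472 * L ^ 3 := by
  have hL0 : 0 ≤ L := by linarith
  unfold codes
  simp only [Finset.sum_sigma, Finset.sum_product]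
  -- Here `1728 = 3 ^ 3 * 2 ^ 6` is the fixed loss, `648 = 3 ^ 3 * 2 ^ 2 * 6` the loss per new step
  -- and `12 = 3 * 2 * 2` the loss per third step.
  have hin : ∀ T ∈ Finset.range m, ∀ N ∈ (Finset.range m).powerset,
      ∑ Y ∈ (Finset.range m).powerset with Y.card ≤ N.card,
          ∑ _X ∈ (Finset.range m).powerset with _X.card ≤ T,
            codeWeight L Θ δ N.card Y.card T ≤
      (12 * L ^ 2 * Θ * (m * δ)) ^ T * ((1728 * L ^ 3) * ((648 * L ^ 3 * m * δ ^ 2) ^ N.card *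
        (N.card + 3).factorial)) := by
    intro T hT N hN
    have hT' : T ≤ m := (Finset.mem_range.1 hT).le
    have e1 : ((∑ Y ∈ (Finset.range m).powerset with Y.card ≤ N.card,
        (max 1 Y.card) ^ N.card : ℕ) : ℝ) ≤ (6 * m) ^ N.card := by
      exact_mod_cast sum_max_pow_le hm N.card
    have e2 : ((((Finset.range m).powerset.filter fun X => X.card ≤ T).card * T.factorial : ℕ) : ℝ)
        ≤ (2 * m) ^ T := by exact_mod_cast card_powerset_mul_factorial_le hT'
    calc _ = (3 * L) ^ (3 * N.card + T + 3) * L ^ T * (δ ^ 2) ^ N.card * (N.card + 3).factorial *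
          ((δ * Θ) ^ T * 2 ^ (2 * (N.card + 3) + T)) *
          (((∑ Y ∈ (Finset.range m).powerset with Y.card ≤ N.card,
            (max 1 Y.card) ^ N.card : ℕ) : ℝ)) *
          ((((Finset.range m).powerset.filter fun X => X.card ≤ T).card * T.factorial : ℕ) : ℝ) := by
          simp only [Finset.sum_const, nsmul_eq_mul]
          push_cast
          rw [Finset.mul_sum, Finset.sum_mul]
          refine Finset.sum_congr rfl fun Y _ => ?_
          unfold codeWeight
          push_cast
          rw [mul_pow]
          ring
      _ ≤ (3 * L) ^ (3 * N.card + T + 3) * L ^ T * (δ ^ 2) ^ N.card * (N.card + 3).factorial *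
          ((δ * Θ) ^ T * 2 ^ (2 * (N.card + 3) + T)) * (6 * m) ^ N.card * (2 * m) ^ T := by
          gcongr
      _ = _ := by
          have a1 : (12 * L ^ 2 * Θ * (m * δ)) ^ T =
            (3 * L) ^ T * L ^ T * (δ * Θ) ^ T * 2 ^ T * (2 * m) ^ T := by
            simp only [← mul_pow]; congr 1; ring
          have a2 : (648 * L ^ 3 * m * δ ^ 2) ^ N.card =
            ((3 * L) ^ 3) ^ N.card * (δ ^ 2) ^ N.card * (2 ^ 2) ^ N.card * (6 * m) ^ N.card := by
            simp only [← mul_pow]; congr 1; ring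
          rw [a1, a2, pow_add, pow_add, pow_add, pow_mul, mul_add, pow_add, pow_mul 2 2]
          ring
  have hN : ∑ N ∈ (Finset.range m).powerset,
      (1728 * L ^ 3) * ((648 * L ^ 3 * m * δ ^ 2) ^ N.card * (N.card + 3).factorial) ≤
      20736 * L ^ 3 := by
    rw [← Finset.mul_sum, Finset.sum_powerset_apply_card
      (fun i => (648 * L ^ 3 * m * δ ^ 2) ^ i * ((i + 3).factorial : ℝ)), Finset.card_range]
    have : ∀ i ∈ Finset.range (m + 1),
        m.choose i • ((648 * L ^ 3 * m * δ ^ 2) ^ i * ((i + 3).factorial : ℝ)) ≤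
          6 * (2592 * L ^ 3 * (m * δ) ^ 2) ^ i := by
      intro i _
      have e1 : ((i + 3).factorial : ℝ) ≤ 6 * 4 ^ i * i.factorial := by
        exact_mod_cast factorial_add_three_le i
      have e2 : (m.choose i : ℝ) * i.factorial ≤ m ^ i := by
        exact_mod_cast choose_mul_factorial_le_pow m i
      rw [nsmul_eq_mul]
      calc (m.choose i : ℝ) * ((648 * L ^ 3 * m * δ ^ 2) ^ i * ((i + 3).factorial : ℝ)) ≤
            m.choose i * ((648 * L ^ 3 * m * δ ^ 2) ^ i * (6 * 4 ^ i * i.factorial)) := by gcongr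
        _ = (648 * L ^ 3 * m * δ ^ 2) ^ i * 6 * 4 ^ i * (m.choose i * i.factorial) := by ring
        _ ≤ (648 * L ^ 3 * m * δ ^ 2) ^ i * 6 * 4 ^ i * m ^ i := by gcongr
        _ = 6 * (648 * L ^ 3 * m * δ ^ 2 * 4 * m) ^ i := by
            rw [mul_pow (648 * L ^ 3 * m * δ ^ 2 * 4), mul_pow _ (4 : ℝ)]; ring
        _ = _ := by congr 2; ring
    calc _ ≤ 1728 * L ^ 3 * ∑ i ∈ Finset.range (m + 1), 6 * (2592 * L ^ 3 * (m * δ) ^ 2) ^ i := by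
          gcongr with i hi
          exact this i hi
      _ ≤ 1728 * L ^ 3 * (6 * 2) := by
          rw [← Finset.mul_sum]
          gcongr
          exact sum_geometric_le_two (by positivity) h1 _
      _ = _ := by ring
  calc _ ≤ ∑ T ∈ Finset.range m, ∑ N ∈ (Finset.range m).powerset,
        (12 * L ^ 2 * Θ * (m * δ)) ^ T * ((1728 * L ^ 3) * ((648 * L ^ 3 * m * δ ^ 2) ^ N.card *
        (N.card + 3).factorial)) := Finset.sum_le_sum fun T hT => Finset.sum_le_sum (hin T hT)
    _ = (∑ T ∈ Finset.range m, (12 * L ^ 2 * Θ * (m * δ)) ^ T) * ∑ N ∈ (Finset.range m).powerset,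
        (1728 * L ^ 3) * ((648 * L ^ 3 * m * δ ^ 2) ^ N.card * (N.card + 3).factorial) := by
        simp_rw [← Finset.mul_sum]
        rw [Finset.sum_mul]
    _ ≤ 2 * (20736 * L ^ 3) := by
        gcongr
        exact sum_geometric_le_two (by positivity) h2 _
    _ = _ := by ring

variable {V : Type*} [DecidableEq V]

lemma newSteps_subset (k : ℕ) (w : ℕ → V) : newSteps k w ⊆ Finset.range (2 * k + 2) :=
  fun τ hτ => by
  have := (mem_steps.1 (mem_newSteps.1 hτ).1).2
  exact Finset.mem_range.2 (by omega)

lemma Good.code_mem {k : ℕ} {w : ℕ → V} (hw : Good k w) :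
    (⟨(thirdSteps k w).card, newSteps k w, marked k w, branching k w⟩ :
      Σ _ : ℕ, Σ _ : Finset ℕ, Finset ℕ × Finset ℕ) ∈ codes (2 * k + 2) := by
  rw [mem_codes]
  have h0 : ∀ τ ∈ steps k, τ < 2 * k + 1 := fun τ hτ => (mem_steps.1 hτ).2
  refine ⟨?_, newSteps_subset k w, ⟨?_, Finset.card_image_le⟩, ?_, hw.card_branching_le⟩
  · have : (thirdSteps k w).card ≤ (Finset.range (2 * k + 1)).card := by
      refine Finset.card_le_card fun τ hτ => ?_
      exact Finset.mem_range.2 (h0 τ (mem_thirdSteps.1 hτ).1)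
    rw [Finset.card_range] at this
    exact Nat.lt_succ_of_le this
  · intro σ hσ
    obtain ⟨τ, hτ, rfl⟩ := Finset.mem_image.1 hσ
    have h1 := h0 τ (mem_newSteps.1 hτ).1
    have h2 := firstVisit_le_self w (τ + 1)
    exact Finset.mem_range.2 (by omega)
  · intro σ hσ
    obtain ⟨τ, hτ, rfl⟩ := Finset.mem_image.1 hσ
    have h1 := h0 τ (mem_freshSteps.1 (Finset.mem_filter.1 hτ).1).1
    have h2 := firstVisit_le_self w τ
    exact Finset.mem_range.2 (by omega)

variable [Fintype V] {b : Matrix V V ℝ} {L Θ δ : ℝ} {k : ℕ}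

/-- The total weight of the good pairs of walks is at most linear in the dimension. -/
theorem sum_good_pairWeight_le (hL : 1 ≤ L) (hΘ : 0 ≤ Θ) (hδ : 0 ≤ δ) (hb : ∀ u v, 0 ≤ b u v)
    (hbδ : ∀ u v, b u v ≤ δ)
    (hSL : ∀ l u, ∑ v, ((Matrix.of fun u v => b u v ^ 2) ^ l : Matrix V V ℝ) u v ≤ L)
    (h1 : 2592 * L ^ 3 * ((2 * k + 2 : ℕ) * δ) ^ 2 ≤ 1 / 2)
    (h2 : 12 * L ^ 2 * Θ * ((2 * k + 2 : ℕ) * δ) ≤ 1 / 2)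
    (G : Finset (Fin (2 * k + 1 + 1) → V)) (hG : ∀ p ∈ G, Good k (extend p)) :
    ∑ p ∈ G, pairWeight b Θ k (extend p) ≤ 41472 * L ^ 4 * Fintype.card V := by
  have hL0 : 0 < L := by linarith
  set S : Matrix V V ℝ := Matrix.of fun u v => b u v ^ 2 with hS
  have hSnn : ∀ u v, 0 ≤ S u v := fun u v => sq_nonneg _
  set F : (Σ _ : ℕ, Σ _ : Finset ℕ, Finset ℕ × Finset ℕ) → (Fin (2 * k + 1 + 1) → V) → ℝ := fun c p =>
    codeWeight L Θ δ c.2.1.card c.2.2.1.card c.1 *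
      ∏ τ ∈ Finset.range (2 * k + 1), kernel S L k c.2.1 c.2.2.1 c.2.2.2 τ (extend p) with hF
  have hK : ∀ (c : Σ _ : ℕ, Σ _ : Finset ℕ, Finset ℕ × Finset ℕ) p, 0 ≤ ∏ τ ∈ Finset.range (2 * k + 1),
      kernel S L k c.2.1 c.2.2.1 c.2.2.2 τ
        (extend (m := 2 * k + 1) p) := fun c p =>
    Finset.prod_nonneg fun τ _ => kernel_nonneg hSnn hL0.le _
  have hF0 : ∀ c p, 0 ≤ F c p := fun c p =>
    mul_nonneg (codeWeight_nonneg hL0.le hΘ hδ _ _ _) (hK c p)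
  -- The code of `p` is one of the summands. Summing over all codes decouples code and walk, so the
  -- kernel bound applies with the code fixed.
  have hp : ∀ p ∈ G, pairWeight b Θ k (extend p) ≤ ∑ c ∈ codes (2 * k + 2), F c p := fun p hp => by
    have hw := hG p hp
    refine le_trans ?_ (Finset.single_le_sum (fun c _ => hF0 c p) hw.code_mem)
    refine (hw.pairWeight_le hL hΘ hb hbδ).trans ?_
    exact mul_le_mul_of_nonneg_right (hw.prod_stepLoss_le hL hΘ hδ)
      (hK ⟨(thirdSteps k (extend p)).card, newSteps k (extend p), marked k (extend p),
        branching k (extend p)⟩ p)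
  calc ∑ p ∈ G, pairWeight b Θ k (extend p) ≤ ∑ p ∈ G, ∑ c ∈ codes (2 * k + 2), F c p :=
        Finset.sum_le_sum hp
    _ ≤ ∑ p, ∑ c ∈ codes (2 * k + 2), F c p :=
        Finset.sum_le_univ_sum_of_nonneg fun p => Finset.sum_nonneg fun c _ => hF0 c p
    _ = ∑ c ∈ codes (2 * k + 2), codeWeight L Θ δ c.2.1.card c.2.2.1.card c.1 *
        ∑ p : Fin (2 * k + 1 + 1) → V, ∏ τ ∈ Finset.range (2 * k + 1),
          kernel S L k c.2.1 c.2.2.1 c.2.2.2 τ (extend p) := by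
        rw [Finset.sum_comm]
        simp only [hF, Finset.mul_sum]
    _ ≤ ∑ c ∈ codes (2 * k + 2), codeWeight L Θ δ c.2.1.card c.2.2.1.card c.1 *
        (Fintype.card V * L) := Finset.sum_le_sum fun c _ =>
        mul_le_mul_of_nonneg_left (sum_prod_kernel_le_card_mul hSnn hL0 hSL)
          (codeWeight_nonneg hL0.le hΘ hδ _ _ _)
    _ ≤ 41472 * L ^ 3 * (Fintype.card V * L) := by
        rw [← Finset.sum_mul]
        gcongr
        exact sum_codes_le hL hΘ hδ (by omega) h1 h2
    _ = _ := by ring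

end Total

end WalkPair

/-! ### Expansion of matrix powers over pairs of walks -/

namespace WalkPair

section Expansion

variable {V : Type*} [Fintype V] [DecidableEq V] {R : Type*} [CommSemiring R]

lemma prod_steps {M : Type*} [CommMonoid M] (k : ℕ) (f : ℕ → M) :
    ∏ τ ∈ steps k, f τ =
      (∏ i ∈ Finset.range k, f i) * ∏ i ∈ Finset.range k, f (k + 1 + i) := by
  have h1 : ∏ τ ∈ Finset.range (2 * k + 1), (if τ ≠ k then f τ else 1) = ∏ τ ∈ steps k, f τ := by
    rw [← Finset.prod_filter]
    exact Finset.prod_congr (Finset.filter_ne' _ _) fun _ _ => rfl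
  rw [← h1, show 2 * k + 1 = k + 1 + k by ring, Finset.prod_range_add, Finset.prod_range_succ,
    if_neg (by simp), mul_one]
  congr 1
  · refine Finset.prod_congr rfl fun i hi => if_pos ?_
    have := Finset.mem_range.1 hi; omega
  · refine Finset.prod_congr rfl fun i hi => if_pos ?_
    omega

/-- The sum over walks of a product along the last `j` steps is given by the `j`-th power. -/
lemma sum_walks (B : Matrix V V R) (a j N : ℕ) (hN : N = a + j) (h : (ℕ → V) → V → R)
    (hh : ∀ w w' : ℕ → V, (∀ σ ≤ a, w σ = w' σ) → h w = h w') :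
    ∑ p : Fin (N + 1) → V, h (extend p) (extend p N) *
        ∏ i ∈ Finset.range j, B (extend p (a + i)) (extend p (a + i + 1)) =
      ∑ p : Fin (a + 1) → V, ∑ y, (B ^ j) (extend p a) y * h (extend p) y := by
  subst hN
  induction j generalizing h with
  | zero => simp [Matrix.one_apply]
  | succ j ih =>
    rw [← add_assoc, sum_extend_succ (m := a + j) (f := fun w => h w (w (a + j + 1)) *
      ∏ i ∈ Finset.range (j + 1), B (w (a + i)) (w (a + i + 1)))]
    have h1 : ∀ (p : Fin (a + j + 1) → V) (v : V),
        h (extend (Fin.snoc (α := fun _ => V) p v))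
            (extend (Fin.snoc (α := fun _ => V) p v) (a + j + 1)) *
          ∏ i ∈ Finset.range (j + 1), B (extend (Fin.snoc (α := fun _ => V) p v) (a + i))
            (extend (Fin.snoc (α := fun _ => V) p v) (a + i + 1)) =
        B (extend p (a + j)) v * h (extend p) v *
          ∏ i ∈ Finset.range j, B (extend p (a + i)) (extend p (a + i + 1)) := fun p v => by
      rw [extend_snoc_last, Finset.prod_range_succ, extend_snoc_last, extend_snoc_of_le p v le_rfl,
        hh _ (extend p) fun σ hσ => extend_snoc_of_le p v (by omega)]
      rw [Finset.prod_congr rfl fun i hi => by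
        have := Finset.mem_range.1 hi
        rw [extend_snoc_of_le p v (by omega : a + i ≤ a + j),
          extend_snoc_of_le p v (by omega : a + i + 1 ≤ a + j)]]
      ring
    simp_rw [h1, ← Finset.sum_mul]
    rw [ih (fun w z => ∑ v, B z v * h w v) fun w w' hw => by simp only [hh w w' hw]]
    refine Finset.sum_congr rfl fun p _ => ?_
    simp_rw [pow_succ, Matrix.mul_apply, Finset.mul_sum, Finset.sum_mul]
    rw [Finset.sum_comm]
    simp_rw [mul_assoc]

/-- Expansion of the entrywise product of two matrix powers over pairs of walks. -/
lemma sum_pow_mul_pow (A B : Matrix V V R) (k : ℕ) :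
    ∑ u, ∑ v, (A ^ k) u v * (B ^ k) u v =
      ∑ p : Fin (2 * k + 1 + 1) → V with
        extend p (k + 1) = extend p 0 ∧ extend p (2 * k + 1) = extend p k,
        ∏ τ ∈ steps k, (if τ < k then A else B) (extend p τ) (extend p (τ + 1)) := by
  have h0 : ∀ w : ℕ → V, ∏ τ ∈ steps k, (if τ < k then A else B) (w τ) (w (τ + 1)) =
      (∏ i ∈ Finset.range k, A (w i) (w (i + 1))) *
        ∏ i ∈ Finset.range k, B (w (k + 1 + i)) (w (k + 1 + i + 1)) := fun w => by
    rw [prod_steps]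
    congr 1
    · exact Finset.prod_congr rfl fun i hi => by rw [if_pos (Finset.mem_range.1 hi)]
    · exact Finset.prod_congr rfl fun i hi => by rw [if_neg (by omega)]
  have hA : ∀ w w' : ℕ → V, (∀ σ ≤ k, w σ = w' σ) → ∏ i ∈ Finset.range k, A (w i) (w (i + 1)) =
      ∏ i ∈ Finset.range k, A (w' i) (w' (i + 1)) := fun w w' h =>
    Finset.prod_congr rfl fun i hi => by
      have := Finset.mem_range.1 hi
      rw [h i (by omega), h (i + 1) (by omega)]
  symm
  rw [Finset.sum_filter]
  simp_rw [h0]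
  have h1 := sum_walks B (k + 1) k (2 * k + 1) (by ring) (fun w y =>
    if w (k + 1) = w 0 ∧ y = w k then ∏ i ∈ Finset.range k, A (w i) (w (i + 1)) else 0)
    (fun w w' h => by
      funext y
      rw [h (k + 1) le_rfl, h 0 (by omega), h k (by omega), hA w w' fun σ hσ => h σ (by omega)])
  calc _ = _ := Finset.sum_congr rfl fun p _ => by split_ifs <;> simp
    _ = _ := h1
    _ = ∑ p : Fin (k + 1 + 1) → V, if extend p (k + 1) = extend p 0 then
          (B ^ k) (extend p (k + 1)) (extend p k) *
            ∏ i ∈ Finset.range k, A (extend p i) (extend p (i + 1)) else 0 := by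
        refine Finset.sum_congr rfl fun p _ => ?_
        split_ifs with h <;> simp [h]
    _ = ∑ p : Fin (k + 1) → V, (B ^ k) (extend p 0) (extend p k) *
            ∏ i ∈ Finset.range k, A (extend p (0 + i)) (extend p (0 + i + 1)) := by
        -- Only one label survives at time `k + 1`: the starting point, where the second walk is
        -- attached.
        rw [sum_extend_succ (m := k) (f := fun w => if w (k + 1) = w 0 then
          (B ^ k) (w (k + 1)) (w k) * ∏ i ∈ Finset.range k, A (w i) (w (i + 1)) else 0)]
        refine Finset.sum_congr rfl fun p _ => ?_
        rw [Finset.sum_eq_single (extend p 0)]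
        · rw [extend_snoc_last, extend_snoc_of_le p _ (Nat.zero_le k), if_pos rfl,
            extend_snoc_of_le p _ le_rfl, hA _ (extend p) fun σ hσ => extend_snoc_of_le p _ hσ]
          simp
        · intro v _ hv
          rw [extend_snoc_last, extend_snoc_of_le p _ (Nat.zero_le k), if_neg hv]
        · simp
    _ = ∑ p : Fin (0 + 1) → V, ∑ y, (A ^ k) (extend p 0) y * (B ^ k) (extend p 0) y :=
        sum_walks A 0 k k (by simp) (fun w y => (B ^ k) (w 0) y)
          (fun w w' h => by rw [h 0 le_rfl])
    _ = ∑ u, ∑ v, (A ^ k) u v * (B ^ k) u v :=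
        (Equiv.funUnique (Fin 1) V).sum_comp fun u => ∑ v, (A ^ k) u v * (B ^ k) u v

end Expansion

/-! ### Expected Frobenius norm of a power -/

section Expectation

variable {Ω : Type*} [MeasurableSpace Ω] {μ : Measure Ω} [IsProbabilityMeasure μ] {n : ℕ} {K : ℝ}
  {x : Fin n → Fin n → Ω → ℂ}

/-- The growth rate of the moments of the entries. -/
noncomputable def momentRate (K : ℝ) : ℝ := max 1 (2 * Real.exp 1 * K) ^ 3

lemma one_le_momentRate (K : ℝ) : 1 ≤ momentRate K := one_le_pow₀ (le_max_left _ _)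

/-- The cube in `momentRate` comes from `m + 2 ≤ 3 * m` for `m ≥ 1`. The case `m = 0` uses the exact
unit variance, so that no constant is lost per edge. -/
lemma integral_norm_pow_le (hK : 0 < K) (hx : IsSubexponentialArray μ K x) (i j : Fin n) (m : ℕ) :
    ∫ ω, ‖x i j ω‖ ^ (m + 2) ∂μ ≤ momentRate K ^ m * (m + 1).factorial := by
  rcases Nat.eq_zero_or_pos m with rfl | hm
  · simp [hx.variance_one]
  have hM : ((m + 2 : ℕ) : ℝ) ≤ 2 ^ (m + 2) := by exact_mod_cast Nat.lt_two_pow_self.le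
  have h1 : (1 : ℝ) ≤ max 1 (2 * Real.exp 1 * K) := le_max_left _ _
  calc ∫ ω, ‖x i j ω‖ ^ (m + 2) ∂μ ≤ (K * (m + 2 : ℕ)) ^ (m + 2) :=
        hx.moment_le i j (m + 2) (by omega)
    _ = K ^ (m + 2) * ((m + 2 : ℕ) : ℝ) ^ (m + 2) := mul_pow _ _ _
    _ ≤ K ^ (m + 2) * (Real.exp 1 ^ (m + 2) * ((m + 2).factorial : ℝ)) := by
        gcongr
        exact self_pow_le_exp_mul_factorial (m + 2)
    _ = K ^ (m + 2) * (Real.exp 1 ^ (m + 2) * ((m + 2 : ℕ) * ((m + 1).factorial : ℝ))) := by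
        rw [Nat.factorial_succ (m + 1)]; push_cast; ring
    _ ≤ K ^ (m + 2) * (Real.exp 1 ^ (m + 2) * (2 ^ (m + 2) * ((m + 1).factorial : ℝ))) := by
        gcongr
    _ = (2 * Real.exp 1 * K) ^ (m + 2) * ((m + 1).factorial : ℝ) := by
        rw [mul_pow, mul_pow]; ring
    _ ≤ max 1 (2 * Real.exp 1 * K) ^ (m + 2) * ((m + 1).factorial : ℝ) := by
        gcongr
        exact le_max_right _ _
    _ ≤ max 1 (2 * Real.exp 1 * K) ^ (3 * m) * ((m + 1).factorial : ℝ) := by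
        gcongr
        omega
    _ = _ := by rw [momentRate, ← pow_mul]

lemma memLp_entry (hx : IsSubexponentialArray μ K x) (i j : Fin n) (m : ℕ) (hm : 1 ≤ m) :
    MemLp (x i j) m μ := by
  rw [← integrable_norm_rpow_iff (hx.measurable i j).aestronglyMeasurable (by simp; omega)
    (by simp)]
  simpa using hx.integrable_moment i j m hm

variable {b : Matrix (Fin n) (Fin n) ℝ}

lemma integrable_prod_steps (hx : IsSubexponentialArray μ K x) (c : ℕ → ℂ → ℂ)
    (hcm : ∀ τ, Measurable (c τ)) (hc : ∀ τ z, ‖c τ z‖ = ‖z‖) (s : Finset ℕ) (w : ℕ → Fin n) :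
    Integrable (fun ω => ∏ τ ∈ s, c τ (inhomogeneousMatrix b x ω (w τ) (w (τ + 1)))) μ := by
  -- Hölder with equal exponents `s.card + 1`, whose reciprocals sum to at most one, also for empty
  -- `s`.
  have h := MemLp.prod' (μ := μ) (s := s) (p := fun _ => ((s.card + 1 : ℕ) : ℝ≥0∞))
    (f := fun τ ω => c τ (inhomogeneousMatrix b x ω (w τ) (w (τ + 1)))) fun τ _ => by
      have h1 := (memLp_entry hx (w τ) (w (τ + 1)) (s.card + 1) (by omega)).const_mul
        (b (w τ) (w (τ + 1)) : ℂ)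
      refine h1.of_le (((hcm τ).comp ?_).aestronglyMeasurable) (ae_of_all _ fun ω => ?_)
      · exact (hx.measurable _ _).const_mul _
      · rw [hc]; rfl
  refine h.integrable ?_
  rw [Finset.sum_const, nsmul_eq_mul, ENNReal.one_le_inv, ← div_eq_mul_inv]
  refine ENNReal.div_le_of_le_mul ?_
  rw [one_mul]
  exact_mod_cast Nat.le_succ _

/-- The expected product along a pair of walks is bounded by its weight, and vanishes unless every
edge is traversed at least twice. -/
lemma norm_integral_prod_le (hK : 0 < K) (hx : IsSubexponentialArray μ K x)
    (hb : ∀ i j, 0 ≤ b i j) (c : ℕ → ℂ →ₗᵢ[ℝ] ℂ) {k : ℕ} {w : ℕ → Fin n}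
    (hw : w (k + 1) = w 0) [Decidable (Good k w)] :
    ‖∫ ω, ∏ τ ∈ steps k, c τ (inhomogeneousMatrix b x ω (w τ) (w (τ + 1))) ∂μ‖ ≤
      if Good k w then pairWeight b (momentRate K) k w else 0 := by
  have hΘ : 0 ≤ momentRate K := zero_le_one.trans (one_le_momentRate K)
  set fib : Fin n × Fin n → Finset ℕ := fun e =>
    (steps k).filter fun τ => (w τ, w (τ + 1)) = e with hfib
  set φ : Fin n × Fin n → ℂ → ℂ := fun e z => ∏ τ ∈ fib e, c τ ((b e.1 e.2 : ℂ) * z) with hφ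
  have hφm : ∀ e, Measurable (φ e) := fun e =>
    (continuous_finsetProd _ fun τ _ =>
      (c τ).continuous.comp (continuous_const.mul continuous_id)).measurable
  have hcard : ∀ e, (fib e).card = traversals k w (2 * k + 1) e.1 e.2 := fun e => by
    simp only [hfib, steps, traversals]
    congr 1
    ext τ
    simp only [Finset.mem_filter, Finset.mem_erase, Prod.ext_iff]
    tauto
  have hint : ∫ ω, ∏ τ ∈ steps k, c τ (inhomogeneousMatrix b x ω (w τ) (w (τ + 1))) ∂μ =
      ∏ e, ∫ ω, φ e (x e.1 e.2 ω) ∂μ := by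
    rw [← hx.indep.integral_fun_prod_comp (fun e => (hx.measurable _ _).aemeasurable)
      (fun e => (hφm e).aestronglyMeasurable)]
    refine integral_congr_ae (ae_of_all _ fun ω => ?_)
    simp only [hφ]
    rw [← Finset.prod_fiberwise (steps k) (fun τ => (w τ, w (τ + 1)))]
    refine Finset.prod_congr rfl fun e _ => Finset.prod_congr rfl fun τ hτ => ?_
    rw [← (Finset.mem_filter.1 hτ).2]
    rfl
  have hnorm : ∀ e z, ‖φ e z‖ = b e.1 e.2 ^ (fib e).card * ‖z‖ ^ (fib e).card := fun e z => by
    simp only [hφ, norm_prod, LinearIsometry.norm_map, norm_mul, Complex.norm_real,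
      Real.norm_of_nonneg (hb _ _), Finset.prod_const, mul_pow]
  -- An entry used once has mean zero; conjugation is only real linear, which suffices to take it
  -- out of the integral.
  have hone : ∀ e, (fib e).card = 1 → ∫ ω, φ e (x e.1 e.2 ω) ∂μ = 0 := fun e he => by
    obtain ⟨τ, hτ⟩ := Finset.card_eq_one.1 he
    simp only [hφ, hτ, Finset.prod_singleton]
    have hi : Integrable (x e.1 e.2) μ := by
      have := memLp_entry hx e.1 e.2 1 le_rfl
      rwa [Nat.cast_one, memLp_one_iff_integrable] at this
    have h1 := ((c τ).toContinuousLinearMap).integral_comp_comm (hi.const_mul (b e.1 e.2 : ℂ))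
    simp only [LinearIsometry.coe_toContinuousLinearMap] at h1
    rw [h1, integral_const_mul, hx.mean_zero, mul_zero, map_zero]
  have hbound : ∀ e, (fib e).card ≠ 1 → ‖∫ ω, φ e (x e.1 e.2 ω) ∂μ‖ ≤
      ∏ r ∈ Finset.range (fib e).card, edgeWeight b (momentRate K) e.1 e.2 r := fun e he => by
    refine (norm_integral_le_integral_norm _).trans ?_
    simp only [hnorm]
    rw [integral_const_mul]
    rcases Nat.eq_zero_or_pos (fib e).card with h0 | h0
    · simp [h0]
    · obtain ⟨m, hm⟩ : ∃ m, (fib e).card = m + 2 := ⟨(fib e).card - 2, by omega⟩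
      rw [hm, prod_edgeWeight]
      exact mul_le_mul_of_nonneg_left (integral_norm_pow_le hK hx _ _ m) (pow_nonneg (hb _ _) _)
  rw [hint, norm_prod]
  split_ifs with hG
  · have h1 : pairWeight b (momentRate K) k w = ∏ e : Fin n × Fin n,
        ∏ r ∈ Finset.range (fib e).card, edgeWeight b (momentRate K) e.1 e.2 r := by
      simp only [hcard]
      rw [Fintype.prod_prod_type]
      exact prod_steps_eq (edgeWeight b (momentRate K)) k w
    rw [h1]
    refine Finset.prod_le_prod (fun e _ => norm_nonneg _) fun e _ => hbound e fun he => ?_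
    obtain ⟨τ, hτ⟩ := Finset.card_pos.1 (by omega : 0 < (fib e).card)
    have hτ' := Finset.mem_filter.1 hτ
    have := hG.two_le τ hτ'.1
    rw [hcard e, ← hτ'.2] at he
    simp only at he
    omega
  · have h1 : ∃ τ ∈ steps k, traversals k w (2 * k + 1) (w τ) (w (τ + 1)) < 2 := by
      by_contra! h
      exact hG ⟨hw, h⟩
    obtain ⟨τ, hτ, h2⟩ := h1
    have h3 := count_lt_traversals (w := w) (mem_steps.1 hτ).1 (mem_steps.1 hτ).2
    refine (Finset.prod_eq_zero (Finset.mem_univ (w τ, w (τ + 1))) ?_).le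
    rw [hone _ (by rw [hcard]; simp only; omega), norm_zero]

/-- Conjugation commutes with matrix powers, so the second walk carries the conjugated entries. -/
lemma sum_norm_sq_pow_eq (A : Matrix (Fin n) (Fin n) ℂ) (k : ℕ) :
    ((∑ u, ∑ v, ‖(A ^ k) u v‖ ^ 2 : ℝ) : ℂ) =
      ∑ p : Fin (2 * k + 1 + 1) → Fin n with
        extend p (k + 1) = extend p 0 ∧ extend p (2 * k + 1) = extend p k,
        ∏ τ ∈ steps k, (if τ < k then LinearIsometry.id else Complex.conjLIE.toLinearIsometry :
          ℂ →ₗᵢ[ℝ] ℂ) (A (extend p τ) (extend p (τ + 1))) := by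
  have h := sum_pow_mul_pow A (A.map (starRingEnd ℂ)) k
  have h2 : (A.map (starRingEnd ℂ)) ^ k = (A ^ k).map (starRingEnd ℂ) :=
    (map_pow (starRingEnd ℂ).mapMatrix A k).symm
  rw [h2] at h
  have h3 : ((∑ u, ∑ v, ‖(A ^ k) u v‖ ^ 2 : ℝ) : ℂ) =
      ∑ u, ∑ v, (A ^ k) u v * ((A ^ k).map (starRingEnd ℂ)) u v := by
    push_cast
    simp only [Matrix.map_apply, Complex.mul_conj']
  rw [h3, h]
  refine Finset.sum_congr rfl fun p _ => Finset.prod_congr rfl fun τ _ => ?_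
  split_ifs <;> simp

/-- The expected squared Frobenius norm of a power is at most linear in the dimension. -/
theorem integral_sum_norm_sq_pow_le (hK : 0 < K) (hx : IsSubexponentialArray μ K x)
    (hb : ∀ i j, 0 ≤ b i j) {L δ : ℝ} {k : ℕ} (hL : 1 ≤ L) (hδ : 0 ≤ δ) (hbδ : ∀ i j, b i j ≤ δ)
    (hSL : ∀ l i, ∑ j, (varianceMatrix b ^ l) i j ≤ L)
    (h1 : 2592 * L ^ 3 * ((2 * k + 2 : ℕ) * δ) ^ 2 ≤ 1 / 2)
    (h2 : 12 * L ^ 2 * momentRate K * ((2 * k + 2 : ℕ) * δ) ≤ 1 / 2) :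
    Integrable (fun ω => ∑ u, ∑ v, ‖(inhomogeneousMatrix b x ω ^ k) u v‖ ^ 2) μ ∧
    ∫ ω, ∑ u, ∑ v, ‖(inhomogeneousMatrix b x ω ^ k) u v‖ ^ 2 ∂μ ≤ 41472 * L ^ 4 * n := by
  classical
  have hΘ : 0 ≤ momentRate K := zero_le_one.trans (one_le_momentRate K)
  set c : ℕ → ℂ →ₗᵢ[ℝ] ℂ := fun τ =>
    if τ < k then LinearIsometry.id else Complex.conjLIE.toLinearIsometry with hc
  have hterm : ∀ w : ℕ → Fin n, Integrable (fun ω => ∏ τ ∈ steps k,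
      c τ (inhomogeneousMatrix b x ω (w τ) (w (τ + 1)))) μ := fun w =>
    integrable_prod_steps hx (fun τ => c τ) (fun τ => (c τ).continuous.measurable)
      (fun τ z => (c τ).norm_map z) _ w
  have hi : Integrable (fun ω => ((∑ u, ∑ v, ‖(inhomogeneousMatrix b x ω ^ k) u v‖ ^ 2 : ℝ) : ℂ))
      μ := by
    simp only [sum_norm_sq_pow_eq]
    exact integrable_finsetSum _ fun p _ => hterm (extend p)
  refine ⟨(hi.re).congr (ae_of_all _ fun ω => Complex.ofReal_re _), ?_⟩
  have h3 : ((∫ ω, ∑ u, ∑ v, ‖(inhomogeneousMatrix b x ω ^ k) u v‖ ^ 2 ∂μ : ℝ) : ℂ) =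
      ∑ p : Fin (2 * k + 1 + 1) → Fin n with
        extend p (k + 1) = extend p 0 ∧ extend p (2 * k + 1) = extend p k,
        ∫ ω, ∏ τ ∈ steps k, c τ (inhomogeneousMatrix b x ω (extend p τ) (extend p (τ + 1))) ∂μ := by
    rw [← integral_complex_ofReal]
    simp only [sum_norm_sq_pow_eq]
    exact integral_finsetSum _ fun p _ => hterm (extend p)
  calc _ ≤ ‖((∫ ω, ∑ u, ∑ v, ‖(inhomogeneousMatrix b x ω ^ k) u v‖ ^ 2 ∂μ : ℝ) : ℂ)‖ := by
        rw [Complex.norm_real]; exact le_abs_self _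
    _ ≤ ∑ p : Fin (2 * k + 1 + 1) → Fin n with
        extend p (k + 1) = extend p 0 ∧ extend p (2 * k + 1) = extend p k,
        if Good k (extend p) then pairWeight b (momentRate K) k (extend p) else 0 := by
        rw [h3]
        exact (norm_sum_le _ _).trans (Finset.sum_le_sum fun p hp =>
          norm_integral_prod_le hK hx hb c (Finset.mem_filter.1 hp).2.1)
    _ ≤ 41472 * L ^ 4 * Fintype.card (Fin n) := by
        rw [← Finset.sum_filter]
        exact sum_good_pairWeight_le hL hΘ hδ hb hbδ hSL h1 h2 _ fun p hp =>
          (Finset.mem_filter.1 hp).2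
    _ = _ := by rw [Fintype.card_fin]

end Expectation

end WalkPair

/-! ### Spectral radius and Frobenius norm -/

section SpectralRadius

variable {n : ℕ}

/-- Eigenvalues are bounded by the Frobenius norm. -/
lemma norm_sq_le_of_mem_spectrum {A : Matrix (Fin n) (Fin n) ℂ} {z : ℂ} (hz : z ∈ spectrum ℂ A) :
    ‖z‖ ^ 2 ≤ ∑ u, ∑ v, ‖A u v‖ ^ 2 := by
  rw [← Matrix.spectrum_toLin'] at hz
  obtain ⟨v, hv⟩ := (Module.End.HasEigenvalue.of_mem_spectrum hz).exists_hasEigenvector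
  have h1 : A.mulVec v = z • v := by simpa using hv.apply_eq_smul
  have hpos : 0 < ∑ j, ‖v j‖ ^ 2 := by
    obtain ⟨j, hj⟩ := Function.ne_iff.1 hv.2
    exact Finset.sum_pos' (fun _ _ => by positivity) ⟨j, Finset.mem_univ j, by
      have := norm_pos_iff.2 hj
      positivity⟩
  have h2 : ∀ i, ‖z‖ ^ 2 * ‖v i‖ ^ 2 ≤ (∑ j, ‖A i j‖ ^ 2) * ∑ j, ‖v j‖ ^ 2 := fun i => by
    have h3 : z * v i = ∑ j, A i j * v j := (congrFun h1 i).symm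
    calc ‖z‖ ^ 2 * ‖v i‖ ^ 2 = ‖∑ j, A i j * v j‖ ^ 2 := by rw [← h3, norm_mul, mul_pow]
      _ ≤ (∑ j, ‖A i j‖ * ‖v j‖) ^ 2 := by
        gcongr
        exact (norm_sum_le _ _).trans_eq (by simp)
      _ ≤ _ := Finset.sum_mul_sq_le_sq_mul_sq _ _ _
  have h4 : ‖z‖ ^ 2 * ∑ j, ‖v j‖ ^ 2 ≤ (∑ i, ∑ j, ‖A i j‖ ^ 2) * ∑ j, ‖v j‖ ^ 2 := by
    rw [Finset.mul_sum, Finset.sum_mul]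
    exact Finset.sum_le_sum fun i _ => h2 i
  exact le_of_mul_le_mul_right h4 hpos

/-- For an eigenvalue `z` of `A`, `z ^ k` is one of `A ^ k`, so `‖z‖` is at most the `2 * k`-th root
of the squared Frobenius norm. -/
lemma pow_le_of_ofReal_le_spectralRadius {A : Matrix (Fin n) (Fin n) ℂ} {R : ℝ} (hR : 0 < R)
    {k : ℕ} (hk : 1 ≤ k) (h : ENNReal.ofReal R ≤ spectralRadius ℂ A) :
    R ^ (2 * k) ≤ ∑ u, ∑ v, ‖(A ^ k) u v‖ ^ 2 := by
  set F := ∑ u, ∑ v, ‖(A ^ k) u v‖ ^ 2 with hF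
  have hF0 : 0 ≤ F := by positivity
  by_contra! hlt
  set r : ℝ := F ^ ((2 * k : ℕ) : ℝ)⁻¹ with hr
  have hr0 : 0 ≤ r := Real.rpow_nonneg hF0 _
  have hrF : r ^ (2 * k) = F := Real.rpow_inv_natCast_pow hF0 (by omega)
  have h1 : spectralRadius ℂ A ≤ ENNReal.ofReal r := by
    refine iSup₂_le fun z hz => ?_
    have h2 := norm_sq_le_of_mem_spectrum (spectrum.pow_mem_pow A k hz)
    rw [norm_pow, ← pow_mul, mul_comm, ← hF, ← hrF] at h2
    have h3 : ‖z‖ ≤ r := le_of_pow_le_pow_left₀ (by omega) hr0 h2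
    change ‖z‖ₑ ≤ _
    rw [← ofReal_norm]
    exact ENNReal.ofReal_le_ofReal h3
  have h4 : R ≤ r := (ENNReal.ofReal_le_ofReal_iff hr0).1 (h.trans h1)
  exact absurd (pow_le_pow_left₀ hR.le h4 (2 * k)) (by rw [hrF]; exact not_le.2 hlt)

end SpectralRadius

/-! ### Tail bounds for the spectral radius -/

section Tail

variable {Ω : Type*} [MeasurableSpace Ω] {μ : Measure Ω} [IsProbabilityMeasure μ] {n : ℕ}
  {K L σ δ : ℝ} {x : Fin n → Fin n → Ω → ℂ} {b : Matrix (Fin n) (Fin n) ℝ}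

open WalkPair

/-- Markov's inequality for the squared Frobenius norm, after rescaling `b` by `σ⁻¹`. -/
lemma measure_le_spectralRadius_le_of_pow (hK : 0 < K) (hx : IsSubexponentialArray μ K x)
    (hb : ∀ i j, 0 ≤ b i j) (hL : 1 ≤ L) (hσ : 0 < σ) (hδ : 0 ≤ δ) (hbδ : ∀ i j, b i j ≤ σ * δ)
    (hS : ∀ l i, ∑ j, (varianceMatrix b ^ l) i j ≤ L * σ ^ (2 * l)) {k : ℕ} (hk : 1 ≤ k)
    (hkδ : 72 * L ^ 2 * momentRate K * ((2 * k + 2 : ℕ) * δ) ≤ 1) {y : ℝ} (hy : 0 < y) :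
    μ {ω | ENNReal.ofReal (σ * y) ≤ spectralRadius ℂ (inhomogeneousMatrix b x ω)} ≤
      ENNReal.ofReal (41472 * L ^ 4 * n * (y ^ (2 * k))⁻¹) := by
  have hΘ := one_le_momentRate K
  set b' : Matrix (Fin n) (Fin n) ℝ := σ⁻¹ • b with hb'
  have hA : ∀ ω, inhomogeneousMatrix b x ω = (σ : ℂ) • inhomogeneousMatrix b' x ω := fun ω => by
    ext i j
    have : (σ : ℂ) ≠ 0 := by exact_mod_cast hσ.ne'
    simp only [inhomogeneousMatrix, hb', Matrix.of_apply, Matrix.smul_apply, smul_eq_mul,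
      Complex.ofReal_mul, Complex.ofReal_inv]
    field_simp
  have hV : varianceMatrix b' = (σ ^ 2)⁻¹ • varianceMatrix b := by
    ext i j
    simp [varianceMatrix, hb', mul_pow]
  have hS' : ∀ l i, ∑ j, (varianceMatrix b' ^ l) i j ≤ L := fun l i => by
    rw [hV, smul_pow]
    simp only [Matrix.smul_apply, smul_eq_mul]
    rw [← Finset.mul_sum, inv_pow, inv_mul_le_iff₀ (by positivity), ← pow_mul, mul_comm _ L]
    exact hS l i
  set q := (2 * k + 2 : ℕ) * δ with hq
  have hq0 : 0 ≤ q := by positivity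
  have hq1 : 72 * L ^ 2 * q ≤ 1 := by
    refine le_trans ?_ hkδ
    calc 72 * L ^ 2 * q = 72 * L ^ 2 * 1 * q := by ring
      _ ≤ _ := by gcongr
  -- The constant `72` is chosen with `72 ^ 2 = 2 * 2592`, so one smallness condition covers both.
  have h1 : 2592 * L ^ 3 * q ^ 2 ≤ 1 / 2 := by
    calc 2592 * L ^ 3 * q ^ 2 ≤ 2592 * L ^ 4 * q ^ 2 := by
          gcongr
          norm_num
      _ = (72 * L ^ 2 * q) ^ 2 / 2 := by ring
      _ ≤ 1 ^ 2 / 2 := by gcongr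
      _ = 1 / 2 := by norm_num
  have h2 : 12 * L ^ 2 * momentRate K * q ≤ 1 / 2 := by linarith
  obtain ⟨hi, hle⟩ := integral_sum_norm_sq_pow_le (b := b') hK hx
    (fun i j => by simpa [hb'] using mul_nonneg (inv_nonneg.2 hσ.le) (hb i j)) hL hδ
    (fun i j => by
      simp only [hb', Matrix.smul_apply, smul_eq_mul]
      rw [inv_mul_le_iff₀ hσ]
      exact hbδ i j) hS' h1 h2
  have hsub : {ω | ENNReal.ofReal (σ * y) ≤ spectralRadius ℂ (inhomogeneousMatrix b x ω)} ⊆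
      {ω | y ^ (2 * k) ≤ ∑ u, ∑ v, ‖(inhomogeneousMatrix b' x ω ^ k) u v‖ ^ 2} := fun ω hω => by
    have h3 := pow_le_of_ofReal_le_spectralRadius (mul_pos hσ hy) hk hω
    rw [hA, smul_pow] at h3
    simp only [Matrix.smul_apply, norm_smul, norm_pow, Complex.norm_real,
      Real.norm_of_nonneg hσ.le, mul_pow, ← pow_mul, ← Finset.mul_sum] at h3
    rw [mul_comm k 2] at h3
    exact le_of_mul_le_mul_left h3 (by positivity)
  refine (measure_mono hsub).trans ?_
  rw [← ENNReal.ofReal_toReal (measure_ne_top μ {ω | y ^ (2 * k) ≤ _})]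
  refine ENNReal.ofReal_le_ofReal ?_
  have h4 := (mul_meas_ge_le_integral_of_nonneg (ae_of_all _ fun ω => by positivity) hi
    (y ^ (2 * k))).trans hle
  rw [← div_eq_mul_inv, le_div_iff₀ (by positivity), mul_comm]
  exact h4

/-- The bound with the best admissible power. -/
lemma measure_le_spectralRadius_le_exp (hK : 0 < K) (hx : IsSubexponentialArray μ K x)
    (hb : ∀ i j, 0 ≤ b i j) (hL : 1 ≤ L) (hσ : 0 < σ) (hδ : 0 < δ) (hbδ : ∀ i j, b i j ≤ σ * δ)
    (hS : ∀ l i, ∑ j, (varianceMatrix b ^ l) i j ≤ L * σ ^ (2 * l))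
    (h2 : 2 ≤ (144 * L ^ 2 * momentRate K * δ)⁻¹) {y z : ℝ} (hz : 0 ≤ z) (hz2 : z ≤ 2)
    (hy : Real.exp z ≤ y ^ 2) (hy0 : 0 < y) :
    μ {ω | ENNReal.ofReal (σ * y) ≤ spectralRadius ℂ (inhomogeneousMatrix b x ω)} ≤
      ENNReal.ofReal (41472 * L ^ 4 * Real.exp 4 * n *
        Real.exp (-(144 * L ^ 2 * momentRate K * δ)⁻¹ * z)) := by
  have hΘ := one_le_momentRate K
  set D := 144 * L ^ 2 * momentRate K * δ with hD
  have hD0 : 0 < D := by positivity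
  -- With `k = m - 1` the exponent falls short of `D⁻¹` by less than two, which costs at most `exp
  -- 4` because `z ≤ 2`.
  set m := ⌊D⁻¹⌋₊ with hm
  have hm2 : 2 ≤ m := Nat.le_floor (by exact_mod_cast h2)
  obtain ⟨k, hk⟩ : ∃ k, m = k + 1 := ⟨m - 1, by omega⟩
  have hmle : (m : ℝ) ≤ D⁻¹ := Nat.floor_le (by positivity)
  have hmlt : D⁻¹ < m + 1 := Nat.lt_floor_add_one _
  rw [hk] at hmle hmlt
  have hkδ : 72 * L ^ 2 * momentRate K * ((2 * k + 2 : ℕ) * δ) ≤ 1 := by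
    calc 72 * L ^ 2 * momentRate K * ((2 * k + 2 : ℕ) * δ) = ((k + 1 : ℕ) : ℝ) * D := by
          push_cast; rw [hD]; ring
      _ ≤ D⁻¹ * D := by gcongr
      _ = 1 := inv_mul_cancel₀ hD0.ne'
  refine (measure_le_spectralRadius_le_of_pow hK hx hb hL hσ hδ.le hbδ hS (by omega : 1 ≤ k) hkδ
    hy0).trans (ENNReal.ofReal_le_ofReal ?_)
  have h3 : (y ^ (2 * k))⁻¹ ≤ Real.exp 4 * Real.exp (-D⁻¹ * z) := by
    rw [← Real.exp_add]
    calc (y ^ (2 * k))⁻¹ ≤ (Real.exp z ^ k)⁻¹ := by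
          rw [pow_mul]
          gcongr
      _ = Real.exp (-(k * z)) := by rw [← Real.exp_nat_mul, Real.exp_neg]
      _ ≤ _ := by
          refine Real.exp_le_exp.2 ?_
          push_cast at hmlt
          nlinarith
  calc 41472 * L ^ 4 * n * (y ^ (2 * k))⁻¹ ≤
        41472 * L ^ 4 * n * (Real.exp 4 * Real.exp (-D⁻¹ * z)) := by gcongr
    _ = _ := by ring

/-- Convexity gives `exp (z / 2) ≤ 1 + (e - 1) * z / 2`, and `e < 3`. -/
lemma exp_le_one_add_sq {z : ℝ} (h0 : 0 ≤ z) (h2 : z ≤ 2) : Real.exp z ≤ (1 + z) ^ 2 := by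
  have h := (convexOn_exp).2 (Set.mem_univ 0) (Set.mem_univ 1) (by linarith : 0 ≤ 1 - z / 2)
    (by linarith : 0 ≤ z / 2) (by ring)
  simp only [smul_eq_mul, mul_zero, zero_add, Real.exp_zero, mul_one] at h
  have h1 : Real.exp (z / 2) ≤ 1 + z := by
    have := Real.exp_one_lt_three
    nlinarith
  calc Real.exp z = Real.exp (z / 2) ^ 2 := by rw [← Real.exp_nat_mul]; congr 1; push_cast; ring
    _ ≤ (1 + z) ^ 2 := by gcongr

/-- The small deviation bound. -/
theorem measure_le_spectralRadius_le (hK : 0 < K) (hx : IsSubexponentialArray μ K x)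
    (hb : ∀ i j, 0 ≤ b i j) (hL : 1 ≤ L) (hσ : 0 < σ)
    (hS : ∀ l i, ∑ j, (varianceMatrix b ^ l) i j ≤ L * σ ^ (2 * l)) {t : ℝ} (ht : 0 < t) :
    μ {ω | ENNReal.ofReal (σ * (1 + t * sparsity b)) ≤
        spectralRadius ℂ (inhomogeneousMatrix b x ω)} ≤
      ENNReal.ofReal (41472 * L ^ 4 * Real.exp 4 * n *
        Real.exp (-((288 * L ^ 2 * momentRate K)⁻¹ * σ * t))) := by
  have hΘ := one_le_momentRate K
  have hbs : ∀ i j, b i j ≤ sparsity b := fun i j =>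
    le_ciSup (f := fun p : Fin n × Fin n => b p.1 p.2) (Set.finite_range _).bddAbove (i, j)
  set s := sparsity b with hs
  have hs0 : 0 ≤ s := Real.iSup_nonneg fun p => hb _ _
  -- The zero profile is separate because `δ` must be positive; the spectral radius is then zero,
  -- below the threshold.
  rcases hs0.eq_or_lt with hs' | hs'
  · have hA : ∀ ω, inhomogeneousMatrix b x ω = 0 := fun ω => by
      ext i j
      have : b i j = 0 := le_antisymm ((hbs i j).trans hs'.ge) (hb i j)
      simp [inhomogeneousMatrix, this]
    have : {ω | ENNReal.ofReal (σ * (1 + t * s)) ≤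
        spectralRadius ℂ (inhomogeneousMatrix b x ω)} = ∅ := by
      ext ω
      simp [hA, ← hs', hσ]
    rw [this, measure_empty]
    exact bot_le
  have hn : 1 ≤ n := by
    rcases Nat.eq_zero_or_pos n with rfl | h
    · rw [hs, sparsity, Real.iSup_of_isEmpty] at hs'
      exact absurd hs' (lt_irrefl _)
    · exact h
  have hn' : (1 : ℝ) ≤ n := by exact_mod_cast hn
  set G := 144 * L ^ 2 * momentRate K with hG
  have hG0 : 0 < G := by positivity
  have hG2 : 288 * L ^ 2 * momentRate K = 2 * G := by rw [hG]; ring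
  rw [hG2]
  -- For small `σ * t` the factor `exp 4` makes the claimed bound at least one.
  have htriv : G⁻¹ * (σ * t) ≤ 4 → μ {ω | ENNReal.ofReal (σ * (1 + t * s)) ≤
        spectralRadius ℂ (inhomogeneousMatrix b x ω)} ≤
      ENNReal.ofReal (41472 * L ^ 4 * Real.exp 4 * n * Real.exp (-((2 * G)⁻¹ * σ * t))) := by
    intro h
    refine prob_le_one.trans ?_
    rw [← ENNReal.ofReal_one]
    refine ENNReal.ofReal_le_ofReal ?_
    have h1 : (1 : ℝ) ≤ Real.exp 4 * Real.exp (-((2 * G)⁻¹ * σ * t)) := by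
      rw [← Real.exp_add]
      refine Real.one_le_exp ?_
      have : (2 * G)⁻¹ * σ * t = G⁻¹ * (σ * t) / 2 := by rw [mul_inv]; ring
      linarith
    have h2 : (1 : ℝ) ≤ 41472 * L ^ 4 := by
      have := one_le_pow₀ hL (n := 4)
      linarith
    calc (1 : ℝ) = 1 * 1 * 1 := by norm_num
      _ ≤ (41472 * L ^ 4) * (Real.exp 4 * Real.exp (-((2 * G)⁻¹ * σ * t))) * n := by gcongr
      _ = _ := by ring
  rcases le_or_gt (t * s) 2 with hts | hts
  · set δ := s / σ with hδ
    have hδ0 : 0 < δ := by positivity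
    by_cases h2 : 2 ≤ (G * δ)⁻¹
    · refine (measure_le_spectralRadius_le_exp (y := 1 + t * s) (z := t * s) hK hx hb hL hσ hδ0
        (fun i j => ?_) hS h2 (by positivity) hts (exp_le_one_add_sq (by positivity) hts)
        (by positivity)).trans ?_
      · rw [hδ, mul_div_cancel₀ _ hσ.ne']
        exact hbs i j
      · gcongr
        rw [← hG, neg_mul, neg_le_neg_iff]
        have : (G * δ)⁻¹ * (t * s) = G⁻¹ * σ * t := by rw [hδ]; field_simp
        rw [this, mul_inv]
        have : 0 ≤ G⁻¹ * σ * t := by positivity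
        linarith
    · refine htriv ?_
      rw [not_le] at h2
      have h3 : G⁻¹ * (σ * t) = (G * δ)⁻¹ * (t * s) := by rw [hδ]; field_simp
      rw [h3]
      have : 0 ≤ (G * δ)⁻¹ := by positivity
      nlinarith
  -- Far above `σ` the control level is raised to `σ' ≥ σ`, which `hS` permits. Then `σ' * δ = s`,
  -- and `σ' * 2 = σ * t * s` lies below the threshold; admissible powers now have order `σ * t`.
  · set σ' := σ * (t * s / 2) with hσ'
    have hσ'0 : 0 < σ' := by positivity
    have hσσ' : σ ≤ σ' := le_mul_of_one_le_right hσ.le (by linarith)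
    set δ := 2 / (σ * t) with hδ
    have hδ0 : 0 < δ := by positivity
    have hGδ : (G * δ)⁻¹ = G⁻¹ * (σ * t) / 2 := by rw [hδ]; field_simp
    by_cases h2 : 2 ≤ (G * δ)⁻¹
    · have h3 := measure_le_spectralRadius_le_exp (y := 2) (z := 1) hK hx hb hL hσ'0 hδ0
        (fun i j => ?_) (fun l i => (hS l i).trans ?_) h2 zero_le_one one_le_two ?_ two_pos
      · refine (measure_mono fun ω hω => ?_).trans (h3.trans ?_)
        · refine le_trans (ENNReal.ofReal_le_ofReal ?_) hω
          rw [hσ']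
          nlinarith
        · gcongr
          rw [← hG, hGδ, mul_inv]
          apply le_of_eq
          ring
      · have : σ' * δ = s := by rw [hσ', hδ]; field_simp
        rw [this]
        exact hbs i j
      · gcongr
      · have := Real.exp_one_lt_three
        linarith
    · refine htriv ?_
      rw [not_le, hGδ] at h2
      linarith

end Tail

/-! ### Almost sure consequences -/

section AlmostSure

variable {Ω : Type*} [MeasurableSpace Ω] {μ : Measure Ω}

/-- An exponential tail with linear prefactor at scale `s n = o(1 / log n)` implies an almost sure
bound up to a deterministic null sequence. -/
lemma exists_tendsto_zero_ae_eventually_lt {C₀ c : ℝ} (hc : 0 < c) {ρ : ℕ → Ω → ℝ≥0∞}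
    {σ s : ℕ → ℝ} (hσ : ∀ n, 0 < σ n)
    (hs : s =o[atTop] (fun n : ℕ => (Real.log n)⁻¹))
    (h : ∀ n : ℕ, ∀ t : ℝ, 0 < t → μ {ω | ENNReal.ofReal (σ n * (1 + t * s n)) ≤ ρ n ω} ≤
      ENNReal.ofReal (C₀ * n * Real.exp (-(c * σ n * t)))) :
    ∃ ε : ℕ → ℝ, Tendsto ε atTop (𝓝 0) ∧
      ∀ᵐ ω ∂μ, ∀ᶠ n in atTop, ρ n ω < ENNReal.ofReal (σ n + ε n) := by
  -- The choice `t = 3 * log n / (c * σ n)` turns the tail into `C₀ * n * n ^ (-3)`, which is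
  -- summable, and `ε n = σ n * t * s n`.
  refine ⟨fun n => 3 / c * (s n * Real.log n), ?_, ?_⟩
  · have h1 := hs.tendsto_div_nhds_zero
    simp only [div_inv_eq_mul] at h1
    simpa using h1.const_mul (3 / c)
  have hpos : ∀ n : ℕ, 2 ≤ n → 0 < Real.log n := fun n hn =>
    Real.log_pos (by exact_mod_cast hn)
  -- The restriction `2 ≤ n` makes this `t` positive.
  have hb : ∀ n : ℕ, μ {ω | 2 ≤ n ∧ ENNReal.ofReal (σ n + 3 / c * (s n * Real.log n)) ≤ ρ n ω} ≤
      ENNReal.ofReal (C₀ * (1 / (n : ℝ) ^ 2)) := by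
    intro n
    by_cases hn : 2 ≤ n
    · have hl := hpos n hn
      have hn0 : (0 : ℝ) < n := by exact_mod_cast (by omega : 0 < n)
      have hσn := hσ n
      have h1 := h n (3 / c * Real.log n / σ n) (by positivity)
      have e1 : σ n * (1 + 3 / c * Real.log n / σ n * s n) =
          σ n + 3 / c * (s n * Real.log n) := by field_simp
      have e2 : C₀ * n * Real.exp (-(c * σ n * (3 / c * Real.log n / σ n))) =
          C₀ * (1 / (n : ℝ) ^ 2) := by
        have : -(c * σ n * (3 / c * Real.log n / σ n)) = -((3 : ℕ) * Real.log n) := by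
          push_cast; field_simp
        rw [this, Real.exp_neg, Real.exp_nat_mul, Real.exp_log hn0]
        field_simp
      rw [e1, e2] at h1
      simpa only [hn, true_and] using h1
    · simp [hn]
  have hsum : ∑' n, μ {ω | 2 ≤ n ∧ ENNReal.ofReal (σ n + 3 / c * (s n * Real.log n)) ≤ ρ n ω} ≠ ∞ :=
    ne_top_of_le_ne_top
      ((Real.summable_one_div_nat_pow.2 one_lt_two).mul_left C₀).tsum_ofReal_ne_top
      (ENNReal.tsum_le_tsum hb)
  filter_upwards [ae_eventually_notMem hsum] with ω hω
  filter_upwards [hω, eventually_ge_atTop 2] with n h1 h2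
  simpa [h2] using h1

variable {ρ : ℕ → ℝ≥0∞} {σ ε : ℕ → ℝ}

lemma limsup_le_limsup_of_eventually_lt (hε : Tendsto ε atTop (𝓝 0))
    (h : ∀ᶠ n in atTop, ρ n < ENNReal.ofReal (σ n + ε n)) :
    limsup ρ atTop ≤ limsup (fun n => ENNReal.ofReal (σ n)) atTop := by
  refine ENNReal.le_of_forall_pos_le_add fun η hη _ => ?_
  rw [← limsup_add_const atTop (fun n => ENNReal.ofReal (σ n)) (η : ℝ≥0∞) (by isBoundedDefault)
    (by isBoundedDefault)]
  refine limsup_le_limsup ?_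
  have hη' : (0 : ℝ) < η := hη
  filter_upwards [h, hε.eventually (gt_mem_nhds hη')] with n h1 h2
  refine h1.le.trans (ENNReal.ofReal_add_le.trans ?_)
  gcongr
  exact (ENNReal.ofReal_le_ofReal h2.le).trans (by simp)

lemma limsup_sub_nonpos_of_eventually_lt (hσ : ∀ n, 0 ≤ σ n) (hε : Tendsto ε atTop (𝓝 0))
    (h : ∀ᶠ n in atTop, ρ n < ENNReal.ofReal (σ n + ε n)) :
    limsup (fun n => (ρ n : EReal) - (σ n : EReal)) atTop ≤ 0 := by
  have h0 : Tendsto (fun n => ((|ε n| : ℝ) : EReal)) atTop (𝓝 0) := by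
    have h2 : Tendsto (fun n => |ε n|) atTop (𝓝 0) := by simpa using hε.abs
    exact (continuous_coe_real_ereal.tendsto 0).comp h2
  rw [← h0.limsup_eq]
  refine limsup_le_limsup ?_
  filter_upwards [h] with n h1
  refine EReal.sub_le_of_le_add ?_
  -- As `ε n` may be negative, `|ε n|` keeps the argument of `ENNReal.ofReal` nonnegative, so
  -- nothing is truncated.
  have h2 : ρ n ≤ ENNReal.ofReal (|ε n| + σ n) :=
    h1.le.trans (ENNReal.ofReal_le_ofReal (by linarith [le_abs_self (ε n)]))
  refine (EReal.coe_ennreal_le_coe_ennreal_iff.2 h2).trans ?_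
  rw [EReal.coe_ennreal_ofReal, max_eq_left (add_nonneg (abs_nonneg _) (hσ n)), EReal.coe_add]

end AlmostSure

theorem theorem1p5 (K L : ℝ) (hK : 0 < K) (hL : 0 < L) :
    ∃ C₀ : ℝ, 0 < C₀ ∧ ∃ c : ℝ, 0 < c ∧
      ∀ (Ω : Type*) [MeasurableSpace Ω] (μ : Measure Ω) [IsProbabilityMeasure μ]
        (x : (n : ℕ) → Fin n → Fin n → Ω → ℂ)
        (b : (n : ℕ) → Matrix (Fin n) (Fin n) ℝ) (σ : ℕ → ℝ),
        (∀ n, IsSubexponentialArray μ K (x n)) →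
        (∀ n i j, 0 ≤ b n i j) →
        (∀ n, 0 < σ n) →
        (∀ n, LongTimeControlled (varianceMatrix (b n)) L (σ n)) →
        (fun n => sparsity (b n)) =o[atTop] (fun n : ℕ => (Real.log n)⁻¹) →
        -- small deviations, in every dimension and for every `t > 0`
        (∀ n : ℕ, ∀ t : ℝ, 0 < t →
          μ {ω | ENNReal.ofReal (σ n * (1 + t * sparsity (b n))) ≤
              spectralRadius ℂ (inhomogeneousMatrix (b n) (x n) ω)} ≤
            ENNReal.ofReal (C₀ * n * Real.exp (-(c * σ n * t)))) ∧
        -- almost surely `limsup ρ(A_n) ≤ σ` (stated with `limsup σ_n`, as `σ_n` may depend on `n`)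
        (∀ᵐ ω ∂μ,
          limsup (fun n => spectralRadius ℂ (inhomogeneousMatrix (b n) (x n) ω)) atTop ≤
            limsup (fun n => ENNReal.ofReal (σ n)) atTop) ∧
        -- almost surely `limsup (ρ(A_n) - σ_n) ≤ 0`
        (∀ᵐ ω ∂μ,
          limsup (fun n => ((spectralRadius ℂ (inhomogeneousMatrix (b n) (x n) ω) : ℝ≥0∞) : EReal)
            - (σ n : EReal)) atTop ≤ 0) := by
  -- Enlarging `L` to `max L 1` covers the power zero, whose row sums are one.
  have hL1 : 1 ≤ max L 1 := le_max_right _ _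
  have hΘ := WalkPair.one_le_momentRate K
  refine ⟨41472 * max L 1 ^ 4 * Real.exp 4, by positivity,
    (288 * max L 1 ^ 2 * WalkPair.momentRate K)⁻¹, by positivity, ?_⟩
  intro Ω _ μ _ x b σ hx hb hσ hS hs
  have hrow : ∀ n l i, ∑ j, (varianceMatrix (b n) ^ l) i j ≤ max L 1 * σ n ^ (2 * l) := by
    intro n l i
    have hσn := hσ n
    rcases Nat.eq_zero_or_pos l with rfl | hl
    · simp [Matrix.one_apply]
    · refine ((hS n l hl).1 i).trans ?_
      gcongr
      exact le_max_left _ _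
  have htail : ∀ n : ℕ, ∀ t : ℝ, 0 < t →
      μ {ω | ENNReal.ofReal (σ n * (1 + t * sparsity (b n))) ≤
          spectralRadius ℂ (inhomogeneousMatrix (b n) (x n) ω)} ≤
        ENNReal.ofReal (41472 * max L 1 ^ 4 * Real.exp 4 * n *
          Real.exp (-((288 * max L 1 ^ 2 * WalkPair.momentRate K)⁻¹ * σ n * t))) := fun n t ht =>
    measure_le_spectralRadius_le hK (hx n) (hb n) hL1 (hσ n) (hrow n) ht
  obtain ⟨ε, hε, hae⟩ := exists_tendsto_zero_ae_eventually_lt (by positivity) hσ hs htail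
  refine ⟨htail, ?_, ?_⟩
  · filter_upwards [hae] with ω hω
    exact limsup_le_limsup_of_eventually_lt hε hω
  · filter_upwards [hae] with ω hω
    exact limsup_sub_nonpos_of_eventually_lt (fun n => (hσ n).le) hε hω
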